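/- Let $S_1,\dots,S_N$ ($N\ge 1$) be contracting affine maps of $\mathbb{R}^2$, $S_i(x)=A_ix+b_i$ with $A_i\in \mathrm{GL}(2,\mathbb{R})$, where contracting means that for some $c\in(0,1)$ one has $|S_i(x)-S_i(y)|\le c|x-y|$ for all $x,y$. Let $C\subset\mathbb{R}^2$ be compact, and let $F_C$ be the associated inhomogeneous self-affine set, that is, the unique non-empty compact set with $F_C=\bigcup_{i=1}^N S_i(F_C)\cup C$. For a linear map $T$ of $\mathbb{R}^2$ with singular values $\alpha_1\ge\alpha_2>0$ let $\phi^0(T)=1$, $\phi^t(T)=\alpha_1^t$ for $0<t\le 1$, $\phi^t(T)=\alpha_1\alpha_2^{t-1}$ for $1<t\le 2$ and $\phi^t(T)=|\det T|^{t/2}$ for $t>2$; for an affine map, $\phi^t$ is evaluated at its linear part. For $k\ge 1$ let $s_k\ge 0$ be the unique solution of $\sum_{(i_1,\dots,i_k)\in\{1,\dots,N\}^k}\phi^{s_k}(S_{i_1}\circ\cdots\circ S_{i_k})=1$, and let $s=\lim_{k\to\infty}s_k$ be the affinity dimension of the system. For a non-empty bounded set $F$ let $N_\delta(F)$ be the least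 number of squares of sidelength $\delta$ needed to cover $F$, and let $$\overline{\dim}_{\mathrm B}F=\limsup_{\delta\to0}\frac{\log N_\delta(F)}{-\log\delta},\qquad \underline{\dim}_{\mathrm B}F=\liminf_{\delta\to0}\frac{\log N_\delta(F)}{-\log\delta}$$ be its upper and lower box dimensions. Suppose that the condensation open set condition (COSC) holds: there is an open set $U$ with $C\subset U\setminus\bigcup_{i=1}^N\overline{S_i(U)}$, with $S_i(U)\subset U$ for all $i$, and with $S_i(U)\cap S_j(U)=\emptyset$ for $i\neq j$. If $C$ has a connected component that is not contained in a line, then $$\overline{\dim}_{\mathrm B}F_C=\max\{s,\overline{\dim}_{\mathrm B}C\}$$ and $$\max\{s,\underline{\dim}_{\mathrm B}C\}\le\underline{\dim}_{\mathrm B}F_C\le\max\{s,\overline{\dim}_{\mathrm B}C\}.$$ -/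

import Mathlib

open Set Filter Topology

namespace SelfAffine

/-- An affine iterated function system `S_1, …, S_N` on `ℝⁿ`, indexed by `Fin N`: invertible affine
maps (`x ↦ A x + b` with `A` invertible), each a strict contraction for the Euclidean distance. -/
structure AffineIFS (n N : ℕ) where
  /-- the maps of the system -/
  map : Fin N → (EuclideanSpace ℝ (Fin n) ≃ᵃ[ℝ] EuclideanSpace ℝ (Fin n))
  /-- every map is a contraction -/
  contracting : ∀ i, ∃ c : ℝ, 0 < c ∧ c < 1 ∧ ∀ x y, dist (map i x) (map i y) ≤ c * dist x y

variable {n N : ℕ}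

/-! ### The inhomogeneous attractor -/

/-- `F` is a non-empty compact set with `F = ⋃ i, S_i(F) ∪ C`. -/
def IsAttractor (I : AffineIFS n N) (C F : Set (EuclideanSpace ℝ (Fin n))) : Prop :=
  F.Nonempty ∧ IsCompact F ∧ F = (⋃ i, I.map i '' F) ∪ C

theorem hausdorffEDist_image_le_mul {X : Type*} [PseudoEMetricSpace X] {f : X → X} {K : NNReal}
    (hf : LipschitzWith K f) {s t : Set X} (hs : IsCompact s) (hs' : s.Nonempty)
    (ht : IsCompact t) (ht' : t.Nonempty) :
    Metric.hausdorffEDist (f '' s) (f '' t) ≤ K * Metric.hausdorffEDist s t := by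
  apply Metric.hausdorffEDist_le_of_mem_edist
  · rintro _ ⟨x, hx, rfl⟩
    obtain ⟨y, hy, hxy⟩ := ht.exists_infEDist_eq_edist ht' x
    refine ⟨f y, ⟨y, hy, rfl⟩, (hf x y).trans ?_⟩
    gcongr
    exact hxy ▸ Metric.infEDist_le_hausdorffEDist_of_mem hx
  · rintro _ ⟨x, hx, rfl⟩
    obtain ⟨y, hy, hxy⟩ := hs.exists_infEDist_eq_edist hs' x
    refine ⟨f y, ⟨y, hy, rfl⟩, (hf x y).trans ?_⟩
    gcongr
    rw [Metric.hausdorffEDist_comm]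
    exact hxy ▸ Metric.infEDist_le_hausdorffEDist_of_mem hx

theorem existsUnique_isAttractor [NeZero N] (I : AffineIFS n N)
    {C : Set (EuclideanSpace ℝ (Fin n))} (hC : IsCompact C) : ∃! F, IsAttractor I C F := by
  choose c hc0 hc1 hc using I.contracting
  have hL : ∀ i, LipschitzWith (c i).toNNReal (I.map i) := fun i =>
    LipschitzWith.of_dist_le_mul fun x y => by
      simpa [Real.coe_toNNReal _ (hc0 i).le] using hc i x y
  let K : NNReal := Finset.univ.sup fun i => (c i).toNNReal
  have hK : K < 1 := by
    refine (Finset.sup_lt_iff (by simp)).2 fun i _ => ?_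
    simpa using hc1 i
  let Φ : TopologicalSpace.NonemptyCompacts (EuclideanSpace ℝ (Fin n)) →
      TopologicalSpace.NonemptyCompacts (EuclideanSpace ℝ (Fin n)) := fun A =>
    ⟨⟨(⋃ i, I.map i '' A) ∪ C,
      (isCompact_iUnion fun i => A.isCompact.image (hL i).continuous).union hC⟩,
      (A.nonempty.image (I.map 0)).mono
        ((subset_iUnion (fun i => I.map i '' (A : Set (EuclideanSpace ℝ (Fin n)))) 0).trans subset_union_left)⟩
  have hΦ : ContractingWith K Φ := by
    refine ⟨hK, fun A B => ?_⟩
    change Metric.hausdorffEDist ((⋃ i, I.map i '' (A : Set (EuclideanSpace ℝ (Fin n)))) ∪ C)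
      ((⋃ i, I.map i '' (B : Set (EuclideanSpace ℝ (Fin n)))) ∪ C) ≤
        K * Metric.hausdorffEDist (A : Set (EuclideanSpace ℝ (Fin n))) (B : Set (EuclideanSpace ℝ (Fin n)))
    refine Metric.hausdorffEDist_union_le.trans (max_le ?_ (by simp))
    refine Metric.hausdorffEDist_iUnion_le.trans (iSup_le fun i => ?_)
    refine (hausdorffEDist_image_le_mul (hL i) A.isCompact A.nonempty B.isCompact
      B.nonempty).trans ?_
    gcongr
    exact Finset.le_sup (f := fun i => (c i).toNNReal) (Finset.mem_univ i)
  have : Nonempty (TopologicalSpace.NonemptyCompacts (EuclideanSpace ℝ (Fin n))) := ⟨{0}⟩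
  let A : TopologicalSpace.NonemptyCompacts (EuclideanSpace ℝ (Fin n)) :=
    ContractingWith.fixedPoint Φ hΦ
  refine ⟨(A : Set (EuclideanSpace ℝ (Fin n))), ⟨A.nonempty, A.isCompact, ?_⟩, ?_⟩
  · exact congrArg (fun A : TopologicalSpace.NonemptyCompacts (EuclideanSpace ℝ (Fin n)) =>
      (A : Set (EuclideanSpace ℝ (Fin n)))) hΦ.fixedPoint_isFixedPt.symm
  · rintro F ⟨h1, h2, h3⟩
    have h : Function.IsFixedPt Φ ⟨⟨F, h2⟩, h1⟩ :=
      TopologicalSpace.NonemptyCompacts.ext h3.symm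
    exact congrArg (fun A : TopologicalSpace.NonemptyCompacts (EuclideanSpace ℝ (Fin n)) =>
      (A : Set (EuclideanSpace ℝ (Fin n)))) (hΦ.fixedPoint_unique h)

/-- The inhomogeneous self-affine set `F_C`: the unique non-empty compact set with
`F_C = ⋃ i, S_i(F_C) ∪ C`. -/
noncomputable def attractor [NeZero N] (I : AffineIFS n N)
    (C : Set (EuclideanSpace ℝ (Fin n))) (hC : IsCompact C) : Set (EuclideanSpace ℝ (Fin n)) :=
  (existsUnique_isAttractor I hC).choose

theorem attractor_isAttractor [NeZero N] (I : AffineIFS n N)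
    (C : Set (EuclideanSpace ℝ (Fin n))) (hC : IsCompact C) :
    IsAttractor I C (attractor I C hC) :=
  (existsUnique_isAttractor I hC).choose_spec.1

/-! ### The condensation open set condition -/

/-- The condensation open set condition. -/
def COSC (I : AffineIFS n N) (C : Set (EuclideanSpace ℝ (Fin n))) : Prop :=
  ∃ U : Set (EuclideanSpace ℝ (Fin n)), IsOpen U ∧
    C ⊆ U \ ⋃ i, closure (I.map i '' U) ∧
    (∀ i, I.map i '' U ⊆ U) ∧
    ∀ i j, i ≠ j → (I.map i '' U) ∩ (I.map j '' U) = ∅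

/-! ### The affinity dimension -/

/-- The singular value function `φ^t(T)`. With `α_1 ≥ … ≥ α_n` the singular values of `T` and
`m - 1 < t ≤ m`, it is `α_1 ⋯ α_{m-1} α_m ^ (t - m + 1)` for `0 < t ≤ n`, it is `1` for `t = 0`,
and it is `|det T| ^ (t / n)` for `t > n`. Mathlib numbers the singular values from `0`, so that
`α_j` is `T.singularValues (j - 1)`. -/
noncomputable def singularValueFunction (t : ℝ)
    (T : EuclideanSpace ℝ (Fin n) →ₗ[ℝ] EuclideanSpace ℝ (Fin n)) : ℝ :=
  if t = 0 then 1
  else if t ≤ n then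
    (∏ j ∈ Finset.range (⌈t⌉₊ - 1), T.singularValues j) *
      T.singularValues (⌈t⌉₊ - 1) ^ (t - ⌈t⌉₊ + 1)
  else |LinearMap.det T| ^ (t / n)

/-- `S_𝐢 = S_{i_1} ∘ ⋯ ∘ S_{i_k}` for a word `𝐢 = (i_1, …, i_k)` (multiplication of affine
equivalences is composition). -/
noncomputable def wordMap (I : AffineIFS n N) {k : ℕ} (w : Fin k → Fin N) :
    EuclideanSpace ℝ (Fin n) ≃ᵃ[ℝ] EuclideanSpace ℝ (Fin n) :=
  (List.ofFn fun j => I.map (w j)).prod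

/-- `∑ φ^t(S_𝐢)` over the words `𝐢` of length `k`, where `φ^t` is evaluated at the linear part. -/
noncomputable def levelSum (I : AffineIFS n N) (k : ℕ) (t : ℝ) : ℝ :=
  ∑ w : Fin k → Fin N, singularValueFunction t
    ((wordMap I w).linear : EuclideanSpace ℝ (Fin n) →ₗ[ℝ] EuclideanSpace ℝ (Fin n))

/-- The number `s_k`: the solution `t ≥ 0` of `∑ φ^t(S_𝐢) = 1`, the sum being over the words of
length `k`. For `k, n, N ≥ 1` the sum is continuous and strictly decreasing in `t`, is `N ^ k ≥ 1`
at `t = 0` and tends to `0`, so that the set below has exactly one element. -/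
noncomputable def levelExponent (I : AffineIFS n N) (k : ℕ) : ℝ :=
  sInf {t : ℝ | 0 ≤ t ∧ levelSum I k t = 1}

/-- The affinity dimension `s = lim s_k`. -/
noncomputable def affinityDim (I : AffineIFS n N) : ℝ :=
  limUnder atTop (levelExponent I)

/-! ### Box dimensions -/

/-- A hypercube of sidelength `δ` in `ℝⁿ`: a set congruent to `[0, δ]ⁿ`. -/
def IsHypercube (δ : ℝ) (Q : Set (EuclideanSpace ℝ (Fin n))) : Prop :=
  ∃ e : EuclideanSpace ℝ (Fin n) ≃ᵢ EuclideanSpace ℝ (Fin n),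
    Q = e '' {x | ∀ i, x i ∈ Set.Icc 0 δ}

/-- `N_δ(F)`: the least number of hypercubes of sidelength `δ` that cover `F` (used for bounded `F`
and `δ > 0`, where a finite cover exists). -/
noncomputable def coverNumber (δ : ℝ) (F : Set (EuclideanSpace ℝ (Fin n))) : ℕ :=
  sInf {k : ℕ | ∃ Q : Fin k → Set (EuclideanSpace ℝ (Fin n)),
    (∀ j, IsHypercube δ (Q j)) ∧ F ⊆ ⋃ j, Q j}

/-- Upper box dimension of a non-empty bounded set. The upper limit is taken in `EReal`, where it
needs no boundedness. -/
noncomputable def upperBoxDim (F : Set (EuclideanSpace ℝ (Fin n))) : EReal :=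
  limsup (fun δ : ℝ => ((Real.log (coverNumber δ F) / (-Real.log δ) : ℝ) : EReal)) (𝓝[>] 0)

/-- Lower box dimension of a non-empty bounded set. -/
noncomputable def lowerBoxDim (F : Set (EuclideanSpace ℝ (Fin n))) : EReal :=
  liminf (fun δ : ℝ => ((Real.log (coverNumber δ F) / (-Real.log δ) : ℝ) : EReal)) (𝓝[>] 0)

end SelfAffine

/-! Write α₁ ≥ α₂ for the singular values of a composition S_w. A component of C lying on no line
has more than one point, so C has lower box dimension at least 1. Hence only exponents t ≥ 1 matter,
and there φ^t = α₁ α₂^(t-1) as long as t ≤ 2.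

The COSC gives a neighbourhood V of C inside U that misses every S_i(U), so the images S_w(V) over
all words w are pairwise disjoint. Comparing areas in their union gives ∑ |det A_i| < 1
(`levelSum_one_two_lt_one`). So s_k < 2 for k ≥ 1, and submultiplicativity of φ^t makes s the
infimum of these s_k. The level sums at t are therefore all at least 1 when t < s, and form a
convergent series when s < t ≤ 2.

Upper bound, for t above both s and the upper dimension of C: subdivide F_C by its defining equation
until α₂ is comparable to δ. The pieces S_w(F_C) where the subdivision stops and the pieces S_w(C)
left behind on the way each need at most a constant times δ^(-t) α₁ α₂^(t-1) squares
(`coverNumber_image_attractor_le`), and the sum over all words converges.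

Lower bound, for 1 < t < s: a renewal argument gives finitely many words with α₂ comparable to δ and
∑ φ^t ≥ 1 (`exists_finset_words`). For a non-collinear component K of C, the connected set S_w(K)
has diameter at least a constant times α₁ (`exists_majorAxis_mul_le_dist`), so it meets at least
about α₁/δ squares. By disjointness a square meets boundedly many of these sets
(`sum_majorAxis_le_coverNumber`). Hence N_δ is at least a constant times ∑ α₁/δ ≥ δ^(-t) ∑ φ^t. -/

namespace SelfAffine

/-! ### Singular values of planar maps -/

/-- The Euclidean plane. -/
abbrev Plane := EuclideanSpace ℝ (Fin 2)

/-- An orthonormal basis whose image is orthogonal, with lengths the singular values. -/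
theorem exists_orthonormalBasis_inner_map (T : Plane →ₗ[ℝ] Plane) :
    ∃ b : OrthonormalBasis (Fin 2) ℝ Plane, inner ℝ (T (b 0)) (T (b 1)) = 0 ∧
      ‖T (b 0)‖ = T.singularValues 0 ∧ ‖T (b 1)‖ = T.singularValues 1 := by
  have hn : Module.finrank ℝ Plane = 2 := by simp
  have hT := T.isSymmetric_adjoint_comp_self
  have key : ∀ i j, inner ℝ (T (hT.eigenvectorBasis hn i)) (T (hT.eigenvectorBasis hn j)) =
      T.singularValues j ^ 2 *
        inner ℝ (hT.eigenvectorBasis hn i) (hT.eigenvectorBasis hn j) := by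
    intro i j
    rw [← LinearMap.adjoint_inner_right, ← LinearMap.comp_apply, hT.apply_eigenvectorBasis hn j,
      T.sq_singularValues_fin hn, inner_smul_right]
    simp
  have hnorm : ∀ i, ‖T (hT.eigenvectorBasis hn i)‖ = T.singularValues i := by
    intro i
    have h := key i i
    rw [real_inner_self_eq_norm_sq, real_inner_self_eq_norm_sq,
      (hT.eigenvectorBasis hn).norm_eq_one] at h
    have h1 := T.singularValues_nonneg i
    have h2 := norm_nonneg (T (hT.eigenvectorBasis hn i))
    nlinarith
  refine ⟨hT.eigenvectorBasis hn, ?_, hnorm 0, hnorm 1⟩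
  rw [key, (hT.eigenvectorBasis hn).inner_eq_zero (by decide)]
  simp

theorem norm_sq_map_of_basis (T : Plane →ₗ[ℝ] Plane) {b : OrthonormalBasis (Fin 2) ℝ Plane}
    (h : inner ℝ (T (b 0)) (T (b 1)) = 0) (x : Plane) :
    ‖T x‖ ^ 2 = (inner ℝ (b 0) x * ‖T (b 0)‖) ^ 2 + (inner ℝ (b 1) x * ‖T (b 1)‖) ^ 2 := by
  conv_lhs => rw [← b.sum_repr' x]
  rw [Fin.sum_univ_two, map_add, map_smul, map_smul, ← real_inner_self_eq_norm_sq,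
    inner_add_left, inner_add_right, inner_add_right]
  simp only [real_inner_smul_left, real_inner_smul_right, real_inner_self_eq_norm_sq,
    real_inner_comm (T (b 0)) (T (b 1)), h, norm_smul, mul_pow, Real.norm_eq_abs, sq_abs]
  ring

theorem norm_sq_eq_of_basis (b : OrthonormalBasis (Fin 2) ℝ Plane) (x : Plane) :
    ‖x‖ ^ 2 = inner ℝ (b 0) x ^ 2 + inner ℝ (b 1) x ^ 2 := by
  rw [← b.sum_sq_norm_inner_right x, Fin.sum_univ_two]
  simp

theorem norm_map_le_singularValues (T : Plane →ₗ[ℝ] Plane) (x : Plane) :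
    ‖T x‖ ≤ T.singularValues 0 * ‖x‖ := by
  obtain ⟨b, h, h0, h1⟩ := exists_orthonormalBasis_inner_map T
  have hx := norm_sq_map_of_basis T h x
  have hy := norm_sq_eq_of_basis b x
  rw [h0, h1] at hx
  have h2 := T.singularValues_antitone (zero_le_one' ℕ)
  have h3 := T.singularValues_nonneg 0
  have h4 := T.singularValues_nonneg 1
  refine le_of_sq_le_sq ?_ (by positivity)
  rw [hx, mul_pow _ ‖x‖, hy, mul_pow, mul_pow, mul_add]
  have : T.singularValues 1 ^ 2 ≤ T.singularValues 0 ^ 2 := by gcongr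
  nlinarith [sq_nonneg (inner ℝ (b 1) x)]

theorem singularValues_mul_norm_le (T : Plane →ₗ[ℝ] Plane) (x : Plane) :
    T.singularValues 1 * ‖x‖ ≤ ‖T x‖ := by
  obtain ⟨b, h, h0, h1⟩ := exists_orthonormalBasis_inner_map T
  have hx := norm_sq_map_of_basis T h x
  have hy := norm_sq_eq_of_basis b x
  rw [h0, h1] at hx
  have h2 := T.singularValues_antitone (zero_le_one' ℕ)
  have h3 := T.singularValues_nonneg 0
  have h4 := T.singularValues_nonneg 1
  refine le_of_sq_le_sq ?_ (by positivity)
  rw [hx, mul_pow _ ‖x‖, hy, mul_pow, mul_pow, mul_add]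
  have : T.singularValues 1 ^ 2 ≤ T.singularValues 0 ^ 2 := by gcongr
  nlinarith [sq_nonneg (inner ℝ (b 0) x)]

theorem singularValues_zero_le {T : Plane →ₗ[ℝ] Plane} {c : ℝ}
    (h : ∀ x, ‖T x‖ ≤ c * ‖x‖) : T.singularValues 0 ≤ c := by
  obtain ⟨b, -, h0, -⟩ := exists_orthonormalBasis_inner_map T
  simpa [h0] using h (b 0)

theorem singularValues_mul_eq_abs_det (T : Plane →ₗ[ℝ] Plane) :
    T.singularValues 0 * T.singularValues 1 = |LinearMap.det T| := by
  rw [← LinearMap.normDet_eq_abs_det, LinearMap.normDet_eq_prod_singularValues]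
  simp [Finset.prod_range_succ]

/-- The larger singular value of the linear part of an affine map of the plane. -/
noncomputable def majorAxis (f : Plane ≃ᵃ[ℝ] Plane) : ℝ :=
  (f.linear : Plane →ₗ[ℝ] Plane).singularValues 0

/-- The smaller singular value of the linear part of an affine map of the plane. -/
noncomputable def minorAxis (f : Plane ≃ᵃ[ℝ] Plane) : ℝ :=
  (f.linear : Plane →ₗ[ℝ] Plane).singularValues 1

theorem minorAxis_le_majorAxis (f : Plane ≃ᵃ[ℝ] Plane) : minorAxis f ≤ majorAxis f :=
  LinearMap.singularValues_antitone _ zero_le_one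

theorem minorAxis_pos (f : Plane ≃ᵃ[ℝ] Plane) : 0 < minorAxis f :=
  (LinearMap.injective_iff_forall_lt_finrank_singularValues_pos _).1 f.linear.injective 1 (by simp)

theorem majorAxis_pos (f : Plane ≃ᵃ[ℝ] Plane) : 0 < majorAxis f :=
  (minorAxis_pos f).trans_le (minorAxis_le_majorAxis f)

theorem dist_map_eq_norm (f : Plane ≃ᵃ[ℝ] Plane) (x y : Plane) :
    dist (f x) (f y) = ‖f.linear (x - y)‖ := by
  rw [dist_eq_norm, ← vsub_eq_sub, ← vsub_eq_sub, ← AffineEquiv.coe_toAffineMap, ← AffineMap.linearMap_vsub]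
  rfl

theorem dist_map_le (f : Plane ≃ᵃ[ℝ] Plane) (x y : Plane) :
    dist (f x) (f y) ≤ majorAxis f * dist x y := by
  rw [dist_map_eq_norm, dist_eq_norm]
  exact norm_map_le_singularValues _ _

theorem lipschitzWith_majorAxis (f : Plane ≃ᵃ[ℝ] Plane) : LipschitzWith (majorAxis f).toNNReal f :=
  LipschitzWith.of_dist_le_mul fun x y => by
    simpa [Real.coe_toNNReal _ (majorAxis_pos f).le] using dist_map_le f x y

theorem minorAxis_mul_dist_le (f : Plane ≃ᵃ[ℝ] Plane) (x y : Plane) :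
    minorAxis f * dist x y ≤ dist (f x) (f y) := by
  rw [dist_map_eq_norm, dist_eq_norm]
  exact singularValues_mul_norm_le _ _

theorem majorAxis_le {f : Plane ≃ᵃ[ℝ] Plane} {c : ℝ}
    (h : ∀ x y, dist (f x) (f y) ≤ c * dist x y) : majorAxis f ≤ c := by
  refine singularValues_zero_le fun x => ?_
  have := h x 0
  rw [dist_map_eq_norm] at this
  simpa using this

theorem majorAxis_mul_minorAxis (f : Plane ≃ᵃ[ℝ] Plane) :
    majorAxis f * minorAxis f = |LinearMap.det (f.linear : Plane →ₗ[ℝ] Plane)| :=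
  singularValues_mul_eq_abs_det _

theorem majorAxis_mul_le (f g : Plane ≃ᵃ[ℝ] Plane) :
    majorAxis (f * g) ≤ majorAxis f * majorAxis g := by
  refine majorAxis_le fun x y => ?_
  rw [mul_assoc]
  exact (dist_map_le f _ _).trans (by gcongr; exacts [(majorAxis_pos f).le, dist_map_le g _ _])

theorem axes_mul (f g : Plane ≃ᵃ[ℝ] Plane) :
    majorAxis (f * g) * minorAxis (f * g) =
      (majorAxis f * minorAxis f) * (majorAxis g * minorAxis g) := by
  rw [majorAxis_mul_minorAxis, majorAxis_mul_minorAxis, majorAxis_mul_minorAxis, ← abs_mul,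
    ← LinearMap.det_comp]
  rfl

/-- The product of the axes is multiplicative and the larger axis submultiplicative, which forces
the opposite inequality on the smaller one. -/
theorem minorAxis_mul_le (f g : Plane ≃ᵃ[ℝ] Plane) :
    minorAxis f * minorAxis g ≤ minorAxis (f * g) := by
  have h := axes_mul f g
  have h1 := majorAxis_mul_le f g
  have h2 := minorAxis_pos (f * g)
  refine le_of_mul_le_mul_left ?_ (mul_pos (majorAxis_pos f) (majorAxis_pos g))
  nlinarith

theorem majorAxis_one : majorAxis 1 = 1 := by
  refine le_antisymm (majorAxis_le fun x y => by simp) ?_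
  have := dist_map_le 1 (EuclideanSpace.single 0 1) 0
  simpa using this

theorem minorAxis_one : minorAxis 1 = 1 := by
  have h := majorAxis_mul_minorAxis 1
  have : ((1 : Plane ≃ᵃ[ℝ] Plane).linear : Plane →ₗ[ℝ] Plane) = LinearMap.id := rfl
  rw [majorAxis_one, this] at h
  simpa using h

/-- `φ^t` of the linear part of an affine map. -/
noncomputable def phi (t : ℝ) (f : Plane ≃ᵃ[ℝ] Plane) : ℝ :=
  singularValueFunction t (f.linear : Plane →ₗ[ℝ] Plane)

theorem phi_of_le_one {t : ℝ} (h0 : 0 ≤ t) (h1 : t ≤ 1) (f : Plane ≃ᵃ[ℝ] Plane) :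
    phi t f = majorAxis f ^ t := by
  unfold phi singularValueFunction
  rcases h0.eq_or_lt with rfl | h
  · simp
  have : ⌈t⌉₊ = 1 := by
    rw [Nat.ceil_eq_iff (by norm_num)]
    simpa using ⟨h, h1⟩
  rw [if_neg h.ne', if_pos (by push_cast; linarith), this]
  simp [majorAxis]

theorem phi_of_one_le {t : ℝ} (h1 : 1 ≤ t) (h2 : t ≤ 2) (f : Plane ≃ᵃ[ℝ] Plane) :
    phi t f = majorAxis f * minorAxis f ^ (t - 1) := by
  rcases h1.eq_or_lt with rfl | h
  · simp [phi_of_le_one]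
  unfold phi singularValueFunction
  have : ⌈t⌉₊ = 2 := by
    rw [Nat.ceil_eq_iff (by norm_num)]
    simpa using ⟨h, h2⟩
  rw [if_neg (by linarith), if_pos (by push_cast; linarith), this]
  simp only [Nat.add_one_sub_one, Finset.range_one, Finset.prod_singleton, majorAxis, minorAxis]
  congr 2
  push_cast
  ring

/-- In this form submultiplicativity is visible: the first factor has a nonnegative exponent on a
submultiplicative quantity, and the second is a power of |det|. -/
theorem phi_eq_det {t : ℝ} (h1 : 1 ≤ t) (h2 : t ≤ 2) (f : Plane ≃ᵃ[ℝ] Plane) :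
    phi t f = majorAxis f ^ (2 - t) * (majorAxis f * minorAxis f) ^ (t - 1) := by
  rw [phi_of_one_le h1 h2, Real.mul_rpow (majorAxis_pos f).le (minorAxis_pos f).le, ← mul_assoc,
    ← Real.rpow_add (majorAxis_pos f)]
  norm_num

theorem phi_pos {t : ℝ} (h0 : 0 ≤ t) (h2 : t ≤ 2) (f : Plane ≃ᵃ[ℝ] Plane) : 0 < phi t f := by
  have := majorAxis_pos f
  have := minorAxis_pos f
  rcases le_total t 1 with h1 | h1
  · rw [phi_of_le_one h0 h1]; positivity
  · rw [phi_of_one_le h1 h2]; positivity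

theorem phi_one {t : ℝ} (h0 : 0 ≤ t) (h2 : t ≤ 2) : phi t 1 = 1 := by
  rcases le_total t 1 with h1 | h1
  · rw [phi_of_le_one h0 h1, majorAxis_one, Real.one_rpow]
  · rw [phi_of_one_le h1 h2, majorAxis_one, minorAxis_one, Real.one_rpow, one_mul]

theorem phi_mul_le {t : ℝ} (h0 : 0 ≤ t) (h2 : t ≤ 2) (f g : Plane ≃ᵃ[ℝ] Plane) :
    phi t (f * g) ≤ phi t f * phi t g := by
  have hf := majorAxis_pos f
  have hg := majorAxis_pos g
  have hfg := (majorAxis_pos (f * g)).le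
  have hf' := minorAxis_pos f
  have hg' := minorAxis_pos g
  rcases le_total t 1 with h1 | h1
  · simp_rw [phi_of_le_one h0 h1]
    rw [← Real.mul_rpow hf.le hg.le]
    exact Real.rpow_le_rpow hfg (majorAxis_mul_le f g) h0
  · simp_rw [phi_eq_det h1 h2]
    rw [axes_mul, Real.mul_rpow (mul_pos hf hf').le (mul_pos hg hg').le, mul_mul_mul_comm,
      ← Real.mul_rpow hf.le hg.le]
    gcongr
    exact majorAxis_mul_le f g

theorem continuousOn_phi (f : Plane ≃ᵃ[ℝ] Plane) : ContinuousOn (fun t => phi t f) (Icc 0 2) := by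
  have hu : Icc (0 : ℝ) 2 = Icc 0 1 ∪ Icc 1 2 := by
    rw [Icc_union_Icc_eq_Icc] <;> norm_num
  rw [hu]
  refine ContinuousOn.union_of_isClosed ?_ ?_ isClosed_Icc isClosed_Icc
  · refine ContinuousOn.congr (f := fun t => majorAxis f ^ t) ?_
      fun t ht => phi_of_le_one ht.1 ht.2 f
    exact (Real.continuous_const_rpow (majorAxis_pos f).ne').continuousOn
  · refine ContinuousOn.congr (f := fun t => majorAxis f * minorAxis f ^ (t - 1)) ?_
      fun t ht => phi_of_one_le ht.1 ht.2 f
    refine Continuous.continuousOn (continuous_const.mul ?_)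
    exact (Real.continuous_const_rpow (minorAxis_pos f).ne').comp (by fun_prop)

theorem strictAntiOn_phi {f : Plane ≃ᵃ[ℝ] Plane} (hf : majorAxis f < 1) :
    StrictAntiOn (fun t => phi t f) (Icc 0 2) := by
  have hu : Icc (0 : ℝ) 2 = Icc 0 1 ∪ Icc 1 2 := by
    rw [Icc_union_Icc_eq_Icc] <;> norm_num
  rw [hu]
  refine StrictAntiOn.union (c := 1) ?_ ?_ (isGreatest_Icc zero_le_one) (isLeast_Icc one_le_two)
  · intro a ha b hb hab
    simp only
    rw [phi_of_le_one ha.1 ha.2, phi_of_le_one hb.1 hb.2]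
    exact Real.rpow_lt_rpow_of_exponent_gt (majorAxis_pos f) hf hab
  · intro a ha b hb hab
    simp only
    rw [phi_of_one_le ha.1 ha.2, phi_of_one_le hb.1 hb.2]
    refine mul_lt_mul_of_pos_left ?_ (majorAxis_pos f)
    exact Real.rpow_lt_rpow_of_exponent_gt (minorAxis_pos f)
      ((minorAxis_le_majorAxis f).trans_lt hf) (by linarith)

/-! ### Words and level sums -/

section Words

variable {N : ℕ}

/-- The sum of `g` over all words of length `k`. -/
noncomputable def wordSum (k : ℕ) (g : List (Fin N) → ℝ) : ℝ :=
  ∑ w : Fin k → Fin N, g (List.ofFn w)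

theorem wordSum_zero (g : List (Fin N) → ℝ) : wordSum 0 g = g [] := by
  simp [wordSum]

theorem wordSum_one (g : List (Fin N) → ℝ) : wordSum 1 g = ∑ i, g [i] := by
  unfold wordSum
  rw [← (Equiv.funUnique (Fin 1) (Fin N)).symm.sum_comp]
  simp

theorem wordSum_add (k l : ℕ) (g : List (Fin N) → ℝ) :
    wordSum (k + l) g = wordSum k fun u => wordSum l fun v => g (u ++ v) := by
  unfold wordSum
  rw [← (Fin.appendEquiv k l).sum_comp, Fintype.sum_prod_type]
  simp [Fin.appendEquiv, List.ofFn_fin_append]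

theorem wordSum_succ (k : ℕ) (g : List (Fin N) → ℝ) :
    wordSum (k + 1) g = ∑ i, wordSum k fun v => g (i :: v) := by
  rw [add_comm, wordSum_add, wordSum_one]
  rfl

theorem wordSum_le {k : ℕ} {g h : List (Fin N) → ℝ} (H : ∀ w, w.length = k → g w ≤ h w) :
    wordSum k g ≤ wordSum k h :=
  Finset.sum_le_sum fun w _ => H _ (by simp)

theorem wordSum_congr {k : ℕ} {g h : List (Fin N) → ℝ} (H : ∀ w, w.length = k → g w = h w) :
    wordSum k g = wordSum k h :=
  Finset.sum_congr rfl fun w _ => H _ (by simp)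

theorem wordSum_nonneg {k : ℕ} {g : List (Fin N) → ℝ} (H : ∀ w, 0 ≤ g w) : 0 ≤ wordSum k g :=
  Finset.sum_nonneg fun _ _ => H _

theorem wordSum_mul_left (k : ℕ) (c : ℝ) (g : List (Fin N) → ℝ) :
    wordSum k (fun w => c * g w) = c * wordSum k g :=
  (Finset.mul_sum _ _ _).symm

theorem wordSum_mul_right (k : ℕ) (c : ℝ) (g : List (Fin N) → ℝ) :
    wordSum k (fun w => g w * c) = wordSum k g * c :=
  (Finset.sum_mul _ _ _).symm

theorem wordSum_sum (k : ℕ) {ι : Type*} (s : Finset ι) (g : ι → List (Fin N) → ℝ) :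
    wordSum k (fun w => ∑ i ∈ s, g i w) = ∑ i ∈ s, wordSum k (g i) :=
  Finset.sum_comm

theorem wordSum_pos [NeZero N] {k : ℕ} {g : List (Fin N) → ℝ} (H : ∀ w, 0 < g w) :
    0 < wordSum k g :=
  Finset.sum_pos (fun _ _ => H _) Finset.univ_nonempty

end Words

variable {N : ℕ}

namespace AffineIFS

variable (I : AffineIFS 2 N)

/-- The composition `S_{i_1} ∘ ⋯ ∘ S_{i_k}` for a list `[i_1, …, i_k]`. -/
noncomputable def comp (w : List (Fin N)) : Plane ≃ᵃ[ℝ] Plane := (w.map I.map).prod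

theorem comp_nil : I.comp [] = 1 := rfl

theorem comp_cons (i : Fin N) (w : List (Fin N)) : I.comp (i :: w) = I.map i * I.comp w := by
  simp [comp]

theorem comp_singleton (i : Fin N) : I.comp [i] = I.map i := by
  simp [comp]

theorem comp_append (u v : List (Fin N)) : I.comp (u ++ v) = I.comp u * I.comp v := by
  simp [comp]

theorem levelSum_eq (k : ℕ) (t : ℝ) : levelSum I k t = wordSum k fun w => phi t (I.comp w) := by
  simp [levelSum, wordSum, wordMap, comp, phi, List.map_ofFn, Function.comp_def]

theorem exists_majorAxis_le [NeZero N] : ∃ c, 0 < c ∧ c < 1 ∧ ∀ i, majorAxis (I.map i) ≤ c := by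
  obtain ⟨i, hi⟩ := Finite.exists_max fun i => majorAxis (I.map i)
  refine ⟨_, majorAxis_pos (I.map i), ?_, hi⟩
  obtain ⟨c, -, h1, h⟩ := I.contracting i
  exact (majorAxis_le h).trans_lt h1

theorem exists_le_minorAxis [NeZero N] : ∃ a, 0 < a ∧ ∀ i, a ≤ minorAxis (I.map i) := by
  obtain ⟨i, hi⟩ := Finite.exists_min fun i => minorAxis (I.map i)
  exact ⟨_, minorAxis_pos (I.map i), hi⟩

variable {I}

theorem majorAxis_comp_le {c : ℝ} (hc : ∀ i, majorAxis (I.map i) ≤ c) (w : List (Fin N)) :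
    majorAxis (I.comp w) ≤ c ^ w.length := by
  induction w with
  | nil => simp [comp_nil, majorAxis_one]
  | cons i w ih =>
    rw [comp_cons, List.length_cons, pow_succ']
    refine (majorAxis_mul_le _ _).trans (mul_le_mul (hc i) ih (majorAxis_pos _).le ?_)
    exact (majorAxis_pos _).le.trans (hc i)

theorem majorAxis_comp_le_one [NeZero N] (w : List (Fin N)) : majorAxis (I.comp w) ≤ 1 := by
  obtain ⟨c, h0, h1, hc⟩ := I.exists_majorAxis_le
  exact (majorAxis_comp_le hc w).trans (pow_le_one₀ h0.le h1.le)

theorem majorAxis_comp_lt_one [NeZero N] {w : List (Fin N)} (hw : w ≠ []) :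
    majorAxis (I.comp w) < 1 := by
  obtain ⟨c, h0, h1, hc⟩ := I.exists_majorAxis_le
  exact (majorAxis_comp_le hc w).trans_lt (pow_lt_one₀ h0.le h1 (by simpa using hw))

variable (I)

theorem levelSum_pos [NeZero N] (k : ℕ) {t : ℝ} (h0 : 0 ≤ t) (h2 : t ≤ 2) : 0 < levelSum I k t := by
  rw [levelSum_eq]
  exact wordSum_pos fun w => phi_pos h0 h2 _

theorem levelSum_add_le (k l : ℕ) {t : ℝ} (h0 : 0 ≤ t) (h2 : t ≤ 2) :
    levelSum I (k + l) t ≤ levelSum I k t * levelSum I l t := by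
  rw [levelSum_eq, levelSum_eq, levelSum_eq, wordSum_add, ← wordSum_mul_right]
  refine wordSum_le fun u _ => ?_
  rw [← wordSum_mul_left]
  refine wordSum_le fun v _ => ?_
  rw [comp_append]
  exact phi_mul_le h0 h2 _ _

theorem levelSum_at_zero (k : ℕ) : levelSum I k 0 = (N : ℝ) ^ k := by
  simp [levelSum, singularValueFunction]

theorem continuousOn_levelSum (k : ℕ) : ContinuousOn (levelSum I k) (Icc 0 2) :=
  continuousOn_finsetSum _ fun _ _ => continuousOn_phi _

theorem strictAntiOn_levelSum [NeZero N] {k : ℕ} (hk : k ≠ 0) :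
    StrictAntiOn (levelSum I k) (Icc 0 2) := by
  intro a ha b hb hab
  rw [levelSum_eq, levelSum_eq]
  refine Finset.sum_lt_sum_of_nonempty Finset.univ_nonempty fun w _ => ?_
  refine strictAntiOn_phi (majorAxis_comp_lt_one ?_) ha hb hab
  simpa [List.ofFn_eq_nil_iff] using hk

/-- A geometric series in disguise: for the partial sums S and q = `levelSum I k t`,
submultiplicativity gives S_{k+n} ≤ S_k + q S_n ≤ S_k + q S_{k+n}. -/
theorem sum_levelSum_le {k : ℕ} [NeZero N] {t : ℝ} (h0 : 0 ≤ t) (h2 : t ≤ 2)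
    (hk : levelSum I k t < 1) (n : ℕ) :
    ∑ j ∈ Finset.range n, levelSum I j t ≤
      (∑ j ∈ Finset.range k, levelSum I j t) / (1 - levelSum I k t) := by
  have hpos := fun j => (I.levelSum_pos j h0 h2).le
  refine (Finset.sum_le_sum_of_subset_of_nonneg (Finset.range_mono (Nat.le_add_left n k))
    fun j _ _ => hpos j).trans ?_
  rw [le_div_iff₀ (by linarith), mul_sub, mul_one, sub_le_iff_le_add]
  conv_lhs => rw [Finset.sum_range_add]
  gcongr
  refine (Finset.sum_le_sum fun j _ => I.levelSum_add_le k j h0 h2).trans ?_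
  rw [← Finset.mul_sum, mul_comm]
  refine mul_le_mul_of_nonneg_right ?_ (hpos k)
  exact Finset.sum_le_sum_of_subset_of_nonneg (Finset.range_mono (Nat.le_add_left n k))
    fun j _ _ => hpos j

theorem tendsto_levelSum [NeZero N] {k : ℕ} {t : ℝ} (h0 : 0 ≤ t) (h2 : t ≤ 2)
    (hk : levelSum I k t < 1) : Tendsto (fun n => levelSum I n t) atTop (𝓝 0) :=
  (summable_of_sum_range_le (fun j => (I.levelSum_pos j h0 h2).le)
    (I.sum_levelSum_le h0 h2 hk)).tendsto_atTop_zero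

/-! ### The affinity dimension -/

theorem levelSum_two_lt_one [NeZero N] (h : levelSum I 1 2 < 1) {k : ℕ} (hk : k ≠ 0) :
    levelSum I k 2 < 1 := by
  obtain ⟨k, rfl⟩ := Nat.exists_eq_succ_of_ne_zero hk
  clear hk
  induction k with
  | zero => exact h
  | succ k ih =>
    have h1 := I.levelSum_pos 1 zero_le_two le_rfl
    have h2 := I.levelSum_pos (k + 1) zero_le_two le_rfl
    refine (I.levelSum_add_le (k + 1) 1 zero_le_two le_rfl).trans_lt ?_
    exact mul_lt_one_of_nonneg_of_lt_one_left h2.le ih h.le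

variable {I}

/-- The level sum is at least 1 at 0 and below 1 at 2, so it has a root in [0, 2). Since
`levelExponent` is an infimum, only smaller roots need excluding, and the branch t > 2 of φ^t never
enters. -/
theorem levelExponent_spec [NeZero N] (h : levelSum I 1 2 < 1) {k : ℕ} (hk : k ≠ 0) :
    0 ≤ levelExponent I k ∧ levelExponent I k < 2 ∧ levelSum I k (levelExponent I k) = 1 := by
  have hN : 1 ≤ levelSum I k 0 := by
    rw [levelSum_at_zero]
    exact one_le_pow₀ (by exact_mod_cast NeZero.one_le)
  obtain ⟨t, ht, ht1⟩ := intermediate_value_Icc' zero_le_two (I.continuousOn_levelSum k)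
    ⟨(I.levelSum_two_lt_one h hk).le, hN⟩
  have ht2 : t < 2 := ht.2.lt_of_ne fun h' => by
    have := I.levelSum_two_lt_one h hk
    rw [← h', ht1] at this
    exact this.false
  have : levelExponent I k = t := by
    refine IsLeast.csInf_eq ⟨⟨ht.1, ht1⟩, fun r hr => ?_⟩
    by_contra! hrt
    have := I.strictAntiOn_levelSum hk ⟨hr.1, (hrt.trans ht2).le⟩ ht hrt
    rw [ht1, hr.2] at this
    exact this.false
  rw [this]
  exact ⟨ht.1, ht2, ht1⟩

/-- If t < 2 exceeds the infimum, some level sum at t is below 1, so the level sums at t tend to 0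
and eventually s_n < t. The infimum omits level 0, where the sum is identically 1 and determines no
exponent. -/
theorem tendsto_levelExponent [NeZero N] (h : levelSum I 1 2 < 1) :
    Tendsto (levelExponent I) atTop (𝓝 (⨅ k : ℕ, levelExponent I (k + 1))) := by
  have hspec := fun k : ℕ => levelExponent_spec h k.succ_ne_zero
  have hbdd : BddBelow (range fun k : ℕ => levelExponent I (k + 1)) :=
    ⟨0, by rintro _ ⟨k, rfl⟩; exact (hspec k).1⟩
  rw [← tendsto_add_atTop_iff_nat 1]
  refine tendsto_order.2 ⟨fun a ha => Eventually.of_forall fun k => ha.trans_le (ciInf_le hbdd k),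
    fun t ht => ?_⟩
  rcases le_or_gt 2 t with h2 | h2
  · exact Eventually.of_forall fun k => (hspec k).2.1.trans_le h2
  obtain ⟨k, hk⟩ := exists_lt_of_ciInf_lt ht
  have ht0 := (hspec k).1.trans hk.le
  have hlt : levelSum I (k + 1) t < 1 := by
    rw [← (hspec k).2.2]
    exact I.strictAntiOn_levelSum k.succ_ne_zero ⟨(hspec k).1, (hspec k).2.1.le⟩ ⟨ht0, h2.le⟩ hk
  have hev := (tendsto_add_atTop_iff_nat 1).2 (I.tendsto_levelSum ht0 h2.le hlt)
  filter_upwards [hev.eventually_lt_const one_pos] with n hn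
  by_contra! hle
  have := (I.strictAntiOn_levelSum n.succ_ne_zero).antitoneOn ⟨ht0, h2.le⟩
    ⟨(hspec n).1, (hspec n).2.1.le⟩ hle
  rw [(hspec n).2.2] at this
  linarith

theorem affinityDim_eq_iInf [NeZero N] (h : levelSum I 1 2 < 1) :
    affinityDim I = ⨅ k : ℕ, levelExponent I (k + 1) :=
  (tendsto_levelExponent h).limUnder_eq

theorem affinityDim_le_levelExponent [NeZero N] (h : levelSum I 1 2 < 1) (k : ℕ) :
    affinityDim I ≤ levelExponent I (k + 1) := by
  rw [affinityDim_eq_iInf h]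
  exact ciInf_le ⟨0, by rintro _ ⟨k, rfl⟩; exact (levelExponent_spec h k.succ_ne_zero).1⟩ k

theorem affinityDim_lt_two [NeZero N] (h : levelSum I 1 2 < 1) : affinityDim I < 2 :=
  (affinityDim_le_levelExponent h 0).trans_lt (levelExponent_spec h one_ne_zero).2.1

theorem one_le_levelSum [NeZero N] (h : levelSum I 1 2 < 1) {t : ℝ} (h0 : 0 ≤ t)
    (ht : t < affinityDim I) (k : ℕ) : 1 ≤ levelSum I k t := by
  rcases k with _ | k
  · rw [levelSum_eq, wordSum_zero, comp_nil, phi_one h0 (ht.trans (affinityDim_lt_two h)).le]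
  have hk := levelExponent_spec h k.succ_ne_zero
  have hle := affinityDim_le_levelExponent h k
  rw [← hk.2.2]
  exact (I.strictAntiOn_levelSum k.succ_ne_zero).antitoneOn ⟨h0, by linarith⟩
    ⟨hk.1, hk.2.1.le⟩ (ht.le.trans hle)

theorem exists_sum_levelSum_le [NeZero N] (h : levelSum I 1 2 < 1) {t : ℝ} (h0 : 0 ≤ t)
    (h2 : t ≤ 2) (ht : affinityDim I < t) :
    ∃ B, ∀ n, ∑ j ∈ Finset.range n, levelSum I j t ≤ B := by
  rw [affinityDim_eq_iInf h] at ht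
  obtain ⟨k, hk⟩ := exists_lt_of_ciInf_lt ht
  have hs := levelExponent_spec h k.succ_ne_zero
  refine ⟨_, I.sum_levelSum_le h0 h2 (k := k + 1) ?_⟩
  rw [← hs.2.2]
  exact I.strictAntiOn_levelSum k.succ_ne_zero ⟨hs.1, hs.2.1.le⟩ ⟨h0, h2⟩ hk

end AffineIFS

/-! ### Covering numbers -/

section Cover

variable {δ : ℝ} {F G : Set Plane}

theorem coverNumber_le_card {ι : Type*} [Fintype ι] {Q : ι → Set Plane}
    (hQ : ∀ j, IsHypercube δ (Q j)) (hF : F ⊆ ⋃ j, Q j) :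
    coverNumber δ F ≤ Fintype.card ι := by
  refine Nat.sInf_le ⟨fun j => Q ((Fintype.equivFin ι).symm j), fun j => hQ _, ?_⟩
  rwa [(Fintype.equivFin ι).symm.surjective.iUnion_comp]

/-- Covering squares may be rotated, so the image of a ball can be covered along its own axes. -/
theorem isHypercube_of_basis (b : OrthonormalBasis (Fin 2) ℝ Plane) (v : Plane) :
    IsHypercube δ {y | ∀ i, inner ℝ (b i) (y - v) ∈ Icc 0 δ} := by
  refine ⟨b.repr.symm.toIsometryEquiv.trans (IsometryEquiv.addRight v), ?_⟩
  ext y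
  constructor
  · intro hy
    refine ⟨b.repr (y - v), fun i => ?_, by simp⟩
    rw [b.repr_apply_apply]
    exact hy i
  · rintro ⟨x, hx, rfl⟩ i
    simpa [← b.repr_apply_apply] using hx i

theorem exists_cover_rectangle (b : OrthonormalBasis (Fin 2) ℝ Plane) (p : Plane) {a : Fin 2 → ℝ}
    (hδ : 0 < δ) :
    ∃ Q : Fin (⌊2 * a 0 / δ⌋₊ + 1) × Fin (⌊2 * a 1 / δ⌋₊ + 1) → Set Plane,
      (∀ j, IsHypercube δ (Q j)) ∧ {y | ∀ i, |inner ℝ (b i) (y - p)| ≤ a i} ⊆ ⋃ j, Q j := by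
  refine ⟨fun j => {y | ∀ i, inner ℝ (b i) (y - (p + ((j.1 : ℝ) * δ - a 0) • b 0 +
    ((j.2 : ℝ) * δ - a 1) • b 1)) ∈ Icc 0 δ}, fun j => isHypercube_of_basis b _, fun y hy => ?_⟩
  have hu : ∀ i, ∃ k : Fin (⌊2 * a i / δ⌋₊ + 1),
      inner ℝ (b i) (y - p) - ((k : ℝ) * δ - a i) ∈ Icc 0 δ := by
    intro i
    have hi := abs_le.1 (hy i)
    have h0 : 0 ≤ (inner ℝ (b i) (y - p) + a i) / δ := div_nonneg (by linarith) hδ.le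
    have h1 : ⌊(inner ℝ (b i) (y - p) + a i) / δ⌋₊ ≤ ⌊2 * a i / δ⌋₊ := by
      apply Nat.floor_le_floor
      gcongr
      linarith
    refine ⟨⟨_, Nat.lt_succ_of_le h1⟩, ?_⟩
    have h2 := Nat.floor_le h0
    have h3 := Nat.lt_floor_add_one ((inner ℝ (b i) (y - p) + a i) / δ)
    rw [le_div_iff₀ hδ] at h2
    rw [div_lt_iff₀ hδ] at h3
    constructor <;> simp only <;> linarith
  obtain ⟨k, hk⟩ := hu 0
  obtain ⟨l, hl⟩ := hu 1
  have h01 : inner ℝ (b 0) (b 1) = 0 := b.inner_eq_zero (by decide)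
  have h10 : inner ℝ (b 1) (b 0) = 0 := b.inner_eq_zero (by decide)
  refine mem_iUnion.2 ⟨(k, l), Fin.forall_fin_two.2 ⟨?_, ?_⟩⟩
  · rw [← sub_sub, ← sub_sub, inner_sub_right, inner_sub_right, inner_smul_right, inner_smul_right,
      h01, real_inner_self_eq_norm_sq, b.norm_eq_one]
    simpa using hk
  · rw [← sub_sub, ← sub_sub, inner_sub_right, inner_sub_right, inner_smul_right, inner_smul_right,
      h10, real_inner_self_eq_norm_sq, b.norm_eq_one]
    simpa using hl

theorem coverNumber_rectangle_le (b : OrthonormalBasis (Fin 2) ℝ Plane) (p : Plane)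
    {a : Fin 2 → ℝ} (hδ : 0 < δ) (ha : ∀ i, 0 ≤ a i)
    (hF : ∀ y ∈ F, ∀ i, |inner ℝ (b i) (y - p)| ≤ a i) :
    (coverNumber δ F : ℝ) ≤ (2 * a 0 / δ + 1) * (2 * a 1 / δ + 1) := by
  obtain ⟨Q, hQ, hQF⟩ := exists_cover_rectangle b p (a := a) hδ
  have h := coverNumber_le_card hQ (F := F) (fun y hy => hQF (hF y hy))
  rw [Fintype.card_prod, Fintype.card_fin, Fintype.card_fin] at h
  refine (Nat.cast_le.2 h).trans ?_
  push_cast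
  have h0 := ha 0
  have h1 := ha 1
  gcongr <;> exact Nat.floor_le (by positivity)

theorem exists_cover (hδ : 0 < δ) (hF : Bornology.IsBounded F) :
    ∃ Q : Fin (coverNumber δ F) → Set Plane, (∀ j, IsHypercube δ (Q j)) ∧ F ⊆ ⋃ j, Q j := by
  suffices h : {k : ℕ | ∃ Q : Fin k → Set Plane,
      (∀ j, IsHypercube δ (Q j)) ∧ F ⊆ ⋃ j, Q j}.Nonempty from Nat.sInf_mem h
  obtain ⟨r, hr⟩ := hF.subset_closedBall (0 : Plane)
  let b := EuclideanSpace.basisFun (Fin 2) ℝ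
  obtain ⟨Q, hQ, hQF⟩ := exists_cover_rectangle b 0 (a := fun _ => max r 0) hδ
  let e := Fintype.equivFin (Fin (⌊2 * max r 0 / δ⌋₊ + 1) × Fin (⌊2 * max r 0 / δ⌋₊ + 1))
  refine ⟨_, fun j => Q (e.symm j), fun j => hQ _, ?_⟩
  rw [e.symm.surjective.iUnion_comp]
  refine fun y hy => hQF fun i => ?_
  have := hr hy
  rw [mem_closedBall_zero_iff] at this
  refine (abs_real_inner_le_norm _ _).trans ?_
  rw [b.norm_eq_one, sub_zero, one_mul]
  exact this.trans (le_max_left _ _)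

theorem coverNumber_mono (hδ : 0 < δ) (hG : Bornology.IsBounded G) (h : F ⊆ G) :
    coverNumber δ F ≤ coverNumber δ G := by
  obtain ⟨Q, hQ, hQG⟩ := exists_cover hδ hG
  simpa using coverNumber_le_card hQ (h.trans hQG)

theorem coverNumber_pos (hδ : 0 < δ) (hF : Bornology.IsBounded F) (h : F.Nonempty) :
    0 < coverNumber δ F := by
  obtain ⟨Q, -, hQF⟩ := exists_cover hδ hF
  obtain ⟨x, hx⟩ := h
  obtain ⟨j, -⟩ := mem_iUnion.1 (hQF hx)
  exact j.pos

theorem coverNumber_le_sum {ι : Type*} [Fintype ι] {H : ι → Set Plane} (hδ : 0 < δ)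
    (hH : ∀ i, Bornology.IsBounded (H i)) (hF : F ⊆ ⋃ i, H i) :
    coverNumber δ F ≤ ∑ i, coverNumber δ (H i) := by
  choose Q hQ hQH using fun i => exists_cover hδ (hH i)
  have := coverNumber_le_card (ι := Σ i, Fin (coverNumber δ (H i))) (F := F)
    (Q := fun j => Q j.1 j.2) (fun j => hQ _ _) ?_
  · simpa using this
  · rw [iUnion_sigma]
    exact hF.trans (iUnion_mono hQH)

theorem coverNumber_union_le (hδ : 0 < δ) (hF : Bornology.IsBounded F)
    (hG : Bornology.IsBounded G) :
    coverNumber δ (F ∪ G) ≤ coverNumber δ F + coverNumber δ G := by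
  have := coverNumber_le_sum (H := fun i : Bool => cond i F G) hδ (Bool.forall_bool.2 ⟨hG, hF⟩)
    (union_eq_iUnion (s₁ := F) (s₂ := G)).le
  simpa using this

theorem IsHypercube.dist_le {Q : Set Plane} (hQ : IsHypercube δ Q) {x y : Plane}
    (hx : x ∈ Q) (hy : y ∈ Q) : dist x y ≤ 2 * δ := by
  obtain ⟨e, rfl⟩ := hQ
  obtain ⟨x, hx, rfl⟩ := hx
  obtain ⟨y, hy, rfl⟩ := hy
  have hδ : 0 ≤ δ := (hx 0).1.trans (hx 0).2
  rw [e.dist_eq, EuclideanSpace.dist_eq, Fin.sum_univ_two]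
  have h : ∀ i, dist (x i) (y i) ^ 2 ≤ δ ^ 2 := fun i => by
    gcongr
    rw [Real.dist_eq, abs_le]
    have := hx i
    have := hy i
    simp only [mem_Icc] at *
    constructor <;> linarith
  rw [Real.sqrt_le_left (by positivity)]
  nlinarith [h 0, h 1]

theorem IsHypercube.exists_subset_closedBall {Q : Set Plane} (hQ : IsHypercube δ Q) :
    ∃ p, Q ⊆ Metric.closedBall p (2 * δ) := by
  rcases Q.eq_empty_or_nonempty with rfl | ⟨p, hp⟩
  · exact ⟨0, empty_subset _⟩
  · exact ⟨p, fun x hx => hQ.dist_le hx hp⟩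

theorem coverNumber_image_le_of_subset_closedBall (f : Plane ≃ᵃ[ℝ] Plane) {p : Plane} {r : ℝ}
    (hδ : 0 < δ) (hr : 0 ≤ r) (hF : F ⊆ Metric.closedBall p r) :
    (coverNumber δ (f '' F) : ℝ) ≤
      (2 * (majorAxis f * r) / δ + 1) * (2 * (minorAxis f * r) / δ + 1) := by
  obtain ⟨b, h, h0, h1⟩ := exists_orthonormalBasis_inner_map (f.linear : Plane →ₗ[ℝ] Plane)
  change _ = majorAxis f at h0
  change _ = minorAxis f at h1
  have hM := majorAxis_pos f
  have hm := minorAxis_pos f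
  let a : Fin 2 → ℝ := ![majorAxis f, minorAxis f]
  have ha : ∀ i, ‖f.linear (b i)‖ = a i := Fin.forall_fin_two.2 ⟨h0, h1⟩
  have hapos : ∀ i, 0 < a i := Fin.forall_fin_two.2 ⟨hM, hm⟩
  -- The directions of the axes of the image ellipse; in these coordinates f stretches the i-th
  -- coordinate by `a i`.
  let v : Fin 2 → Plane := fun i => (a i)⁻¹ • f.linear (b i)
  have hv : Orthonormal ℝ v := by
    refine ⟨fun i => ?_, ?_⟩
    · rw [norm_smul, ha, norm_inv, Real.norm_of_nonneg (hapos i).le,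
        inv_mul_cancel₀ (hapos i).ne']
    · have h01 : inner ℝ (v 0) (v 1) = 0 := by
        simp only [v, real_inner_smul_left, real_inner_smul_right]
        rw [show inner ℝ (f.linear (b 0)) (f.linear (b 1)) = 0 from h]
        simp
      intro i j hij
      fin_cases i <;> fin_cases j
      · exact absurd rfl hij
      · exact h01
      · exact (real_inner_comm _ _).trans h01
      · exact absurd rfl hij
  obtain ⟨g, hg⟩ := Orthonormal.exists_orthonormalBasis_extension_of_card_eq (v := v) (s := univ)
    (by simp) (hv.comp _ Subtype.val_injective)
  refine coverNumber_rectangle_le g (f p) (a := fun i => a i * r) hδ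
    (fun i => mul_nonneg (hapos i).le hr) ?_
  rintro _ ⟨y, hy, rfl⟩ i
  have hfy : f y - f p = f.linear (y - p) := by
    rw [← vsub_eq_sub, ← vsub_eq_sub, ← AffineEquiv.coe_toAffineMap, ← AffineMap.linearMap_vsub]
    rfl
  have hinner : ∀ i, inner ℝ (f.linear (b i)) (f.linear (y - p)) =
      a i ^ 2 * inner ℝ (b i) (y - p) := by
    have hc : inner ℝ (f.linear (b 0)) (f.linear (b 1)) = 0 := h
    have hc' := (real_inner_comm (f.linear (b 0)) (f.linear (b 1))).trans hc
    have hz : f.linear (y - p) = inner ℝ (b 0) (y - p) • f.linear (b 0) +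
        inner ℝ (b 1) (y - p) • f.linear (b 1) := by
      conv_lhs => rw [← b.sum_repr' (y - p)]
      rw [Fin.sum_univ_two, map_add, map_smul, map_smul]
    refine Fin.forall_fin_two.2 ⟨?_, ?_⟩ <;>
    · rw [hz, inner_add_right, inner_smul_right, inner_smul_right]
      simp only [hc, hc', real_inner_self_eq_norm_sq, ha]
      ring
  rw [hg i trivial, hfy, real_inner_smul_left, hinner, ← mul_assoc, sq, ← mul_assoc,
    inv_mul_cancel₀ (hapos i).ne', one_mul, abs_mul, abs_of_pos (hapos i)]
  refine mul_le_mul_of_nonneg_left ?_ (hapos i).le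
  refine (abs_real_inner_le_norm _ _).trans ?_
  rw [b.norm_eq_one, one_mul, ← dist_eq_norm]
  exact hF hy

theorem coverNumber_image_le (f : Plane ≃ᵃ[ℝ] Plane) {ρ : ℝ} (hδ : 0 < δ) (hρ : 0 < ρ)
    (hF : Bornology.IsBounded F) :
    (coverNumber δ (f '' F) : ℝ) ≤ coverNumber ρ F *
      ((2 * (majorAxis f * (2 * ρ)) / δ + 1) * (2 * (minorAxis f * (2 * ρ)) / δ + 1)) := by
  obtain ⟨Q, hQ, hQF⟩ := exists_cover hρ hF
  have hb : ∀ j, Bornology.IsBounded (f '' Q j) := fun j => by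
    obtain ⟨p, hp⟩ := (hQ j).exists_subset_closedBall
    exact (lipschitzWith_majorAxis f).isBounded_image (Metric.isBounded_closedBall.subset hp)
  have h := coverNumber_le_sum hδ hb (F := f '' F) (by rw [← image_iUnion]; exact image_mono hQF)
  refine (Nat.cast_le.2 h).trans ?_
  push_cast
  refine (Finset.sum_le_card_nsmul _ _
    ((2 * (majorAxis f * (2 * ρ)) / δ + 1) * (2 * (minorAxis f * (2 * ρ)) / δ + 1))
    fun j _ => ?_).trans_eq ?_
  · obtain ⟨p, hp⟩ := (hQ j).exists_subset_closedBall
    exact coverNumber_image_le_of_subset_closedBall f hδ (by positivity) hp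
  · simp

/-- The distance from x maps K onto an interval reaching from 0 to `dist x y`, and maps each square
into a set of length at most 2δ; compare Lebesgue measures. -/
theorem dist_le_card_mul {ι : Type*} {K : Set Plane} (hK : IsPreconnected K) {Q : ι → Set Plane}
    (s : Finset ι) (hQ : ∀ j, IsHypercube δ (Q j)) (hKQ : K ⊆ ⋃ j ∈ s, Q j) (hδ : 0 < δ)
    {x y : Plane} (hx : x ∈ K) (hy : y ∈ K) : dist x y ≤ s.card * (2 * δ) := by
  have hc : Continuous fun z : Plane => dist x z := by fun_prop
  have hpre := (hK.image _ hc.continuousOn).ordConnected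
  have h1 : Icc 0 (dist x y) ⊆ ⋃ j ∈ s, (fun z => dist x z) '' Q j := by
    refine (hpre.out ⟨x, hx, dist_self x⟩ ⟨y, hy, rfl⟩).trans ?_
    rw [← image_iUnion₂]
    exact image_mono hKQ
  have h2 : ∀ j, MeasureTheory.volume ((fun z => dist x z) '' Q j) ≤ ENNReal.ofReal (2 * δ) := by
    refine fun j => (Real.volume_le_diam _).trans (Metric.ediam_le ?_)
    rintro _ ⟨u, hu, rfl⟩ _ ⟨v, hv, rfl⟩
    rw [edist_dist]
    refine ENNReal.ofReal_le_ofReal ?_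
    refine le_trans ?_ ((hQ j).dist_le hu hv)
    simp only [Real.dist_eq]
    rw [dist_comm x u, dist_comm x v]
    exact abs_dist_sub_le u v x
  have h3 := (MeasureTheory.measure_mono h1).trans ((MeasureTheory.measure_biUnion_finset_le
    (μ := MeasureTheory.volume) s _).trans (Finset.sum_le_card_nsmul s _ _ fun j _ => h2 j))
  rw [Real.volume_Icc, sub_zero, ← ENNReal.ofReal_nsmul,
    ENNReal.ofReal_le_ofReal_iff (by positivity), nsmul_eq_mul] at h3
  exact h3

end Cover

/-! ### Box dimensions -/

section BoxDim

variable {F G : Set Plane}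

theorem eventually_lt_one : ∀ᶠ δ : ℝ in 𝓝[>] 0, 0 < δ ∧ δ < 1 := by
  filter_upwards [Ioo_mem_nhdsGT one_pos] with δ hδ using hδ

theorem boxDim_quotient_mono (hG : Bornology.IsBounded G) (hF : F.Nonempty) (h : F ⊆ G) :
    ∀ᶠ δ : ℝ in 𝓝[>] 0, ((Real.log (coverNumber δ F) / (-Real.log δ) : ℝ) : EReal) ≤
      ((Real.log (coverNumber δ G) / (-Real.log δ) : ℝ) : EReal) := by
  filter_upwards [eventually_lt_one] with δ ⟨h0, h1⟩
  rw [EReal.coe_le_coe_iff]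
  have hl := Real.log_neg h0 h1
  have hpos : (0 : ℝ) < coverNumber δ F := by
    exact_mod_cast coverNumber_pos h0 (hG.subset h) hF
  have hle : (coverNumber δ F : ℝ) ≤ coverNumber δ G := by
    exact_mod_cast coverNumber_mono h0 hG h
  refine div_le_div_of_nonneg_right ?_ (by linarith)
  exact Real.log_le_log hpos hle

theorem upperBoxDim_mono (hG : Bornology.IsBounded G) (hF : F.Nonempty) (h : F ⊆ G) :
    upperBoxDim F ≤ upperBoxDim G :=
  limsup_le_limsup (boxDim_quotient_mono hG hF h)

theorem lowerBoxDim_mono (hG : Bornology.IsBounded G) (hF : F.Nonempty) (h : F ⊆ G) :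
    lowerBoxDim F ≤ lowerBoxDim G :=
  liminf_le_liminf (boxDim_quotient_mono hG hF h)

theorem lowerBoxDim_le_upperBoxDim : lowerBoxDim F ≤ upperBoxDim F :=
  liminf_le_limsup

theorem tendsto_const_div_neg_log_add (c t : ℝ) :
    Tendsto (fun δ : ℝ => ((c / (-Real.log δ) + t : ℝ) : EReal)) (𝓝[>] 0) (𝓝 t) := by
  rw [EReal.tendsto_coe]
  have h : Tendsto (fun δ : ℝ => -Real.log δ) (𝓝[>] 0) atTop :=
    tendsto_neg_atBot_atTop.comp Real.tendsto_log_nhdsGT_zero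
  simpa using (h.const_div_atTop c).add_const t

theorem log_mul_rpow_div {c t δ : ℝ} (hc : 0 < c) (h0 : 0 < δ) (h1 : δ < 1) :
    Real.log (c * δ ^ (-t)) / (-Real.log δ) = Real.log c / (-Real.log δ) + t := by
  have hl := Real.log_neg h0 h1
  rw [Real.log_mul hc.ne' (Real.rpow_pos_of_pos h0 _).ne', Real.log_rpow h0, add_div]
  congr 1
  rw [neg_mul, neg_div_neg_eq, mul_div_cancel_right₀ _ hl.ne]

theorem upperBoxDim_le_of_coverNumber_le (hF : Bornology.IsBounded F) (hne : F.Nonempty)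
    {c t : ℝ} (hc : 0 < c) (h : ∀ᶠ δ : ℝ in 𝓝[>] 0, (coverNumber δ F : ℝ) ≤ c * δ ^ (-t)) :
    upperBoxDim F ≤ t := by
  rw [← (tendsto_const_div_neg_log_add (Real.log c) t).limsup_eq]
  refine limsup_le_limsup ?_
  filter_upwards [h, eventually_lt_one] with δ hδ ⟨h0, h1⟩
  have hl := Real.log_neg h0 h1
  rw [EReal.coe_le_coe_iff, ← log_mul_rpow_div hc h0 h1]
  refine div_le_div_of_nonneg_right (Real.log_le_log ?_ hδ) (by linarith)
  exact_mod_cast coverNumber_pos h0 hF hne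

theorem le_lowerBoxDim_of_le_coverNumber {c t : ℝ} (hc : 0 < c)
    (h : ∀ᶠ δ : ℝ in 𝓝[>] 0, c * δ ^ (-t) ≤ coverNumber δ F) :
    t ≤ lowerBoxDim F := by
  rw [← (tendsto_const_div_neg_log_add (Real.log c) t).liminf_eq]
  refine liminf_le_liminf ?_
  filter_upwards [h, eventually_lt_one] with δ hδ ⟨h0, h1⟩
  have hl := Real.log_neg h0 h1
  rw [EReal.coe_le_coe_iff, ← log_mul_rpow_div hc h0 h1]
  exact div_le_div_of_nonneg_right (Real.log_le_log (by positivity) hδ) (by linarith)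

theorem eventually_coverNumber_le_rpow {t : ℝ} (h : upperBoxDim F < t) :
    ∀ᶠ δ : ℝ in 𝓝[>] 0, (coverNumber δ F : ℝ) ≤ δ ^ (-t) := by
  filter_upwards [eventually_lt_of_limsup_lt h, eventually_lt_one] with δ hδ ⟨h0, h1⟩
  have hl := Real.log_neg h0 h1
  rw [EReal.coe_lt_coe_iff, div_lt_iff₀ (by linarith)] at hδ
  rcases (coverNumber δ F).eq_zero_or_pos with hz | hz
  · rw [hz, Nat.cast_zero]
    positivity
  · rw [← Real.log_le_log_iff (by exact_mod_cast hz) (by positivity), Real.log_rpow h0]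
    linarith

end BoxDim

/-! ### The upper bound -/

/-- The stopping case: with α₂ comparable to δ, the image is a strip of bounded width in units of δ,
needing about α₁/δ squares, and δ^(t-1) is absorbed into α₂^(t-1). -/
theorem coverNumber_image_le_of_minorAxis_le {F : Set Plane} {f : Plane ≃ᵃ[ℝ] Plane} {p : Plane}
    {a d r t δ : ℝ} (ht : 1 ≤ t) (ha : 0 < a) (hd : 0 < d) (hδ : 0 < δ) (hr : 0 ≤ r)
    (hF : F ⊆ Metric.closedBall p r) (hl : a * (δ / d) ≤ minorAxis f)
    (hu : minorAxis f ≤ δ / d) :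
    (coverNumber δ (f '' F) : ℝ) ≤ (2 * r + d / a) * (2 * r / d + 1) * (d / a) ^ (t - 1) *
      δ ^ (-t) * (majorAxis f * minorAxis f ^ (t - 1)) := by
  have hm := minorAxis_pos f
  have hM := majorAxis_pos f
  have hmM := minorAxis_le_majorAxis f
  refine (coverNumber_image_le_of_subset_closedBall f hδ hr hF).trans ?_
  have hδm : δ ≤ d / a * minorAxis f := by
    rw [div_mul_eq_mul_div, le_div_iff₀ ha]
    rw [mul_div_assoc', div_le_iff₀ hd] at hl
    linarith
  have h1 : 2 * (majorAxis f * r) / δ + 1 ≤ (2 * r + d / a) * (majorAxis f / δ) := by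
    rw [add_mul]
    refine add_le_add (le_of_eq (by ring)) ?_
    rw [mul_div_assoc', le_div_iff₀ hδ, one_mul]
    exact hδm.trans (by gcongr)
  have h2 : 2 * (minorAxis f * r) / δ + 1 ≤ 2 * r / d + 1 := by
    refine add_le_add_left ?_ 1
    rw [div_le_div_iff₀ hδ hd]
    rw [le_div_iff₀ hd] at hu
    nlinarith
  have h3 : majorAxis f / δ ≤
      (d / a) ^ (t - 1) * δ ^ (-t) * (majorAxis f * minorAxis f ^ (t - 1)) := by
    have : δ ^ (t - 1) ≤ (d / a) ^ (t - 1) * minorAxis f ^ (t - 1) := by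
      rw [← Real.mul_rpow (by positivity) hm.le]
      exact Real.rpow_le_rpow hδ.le hδm (by linarith)
    calc majorAxis f / δ = majorAxis f * δ ^ (-t) * δ ^ (t - 1) := by
          rw [mul_assoc, ← Real.rpow_add hδ, div_eq_mul_inv, ← Real.rpow_neg_one]
          congr 2
          ring
      _ ≤ majorAxis f * δ ^ (-t) * ((d / a) ^ (t - 1) * minorAxis f ^ (t - 1)) := by gcongr
      _ = _ := by ring
  calc _ ≤ (2 * r + d / a) * (majorAxis f / δ) * (2 * r / d + 1) := by gcongr
    _ ≤ (2 * r + d / a) * ((d / a) ^ (t - 1) * δ ^ (-t) *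
        (majorAxis f * minorAxis f ^ (t - 1))) * (2 * r / d + 1) := by gcongr
    _ = _ := by ring

/-- At scale ρ = δ/α₂ a square of C has an image of width about δ, covered by (4α₁/α₂ + 1) · 5 ≤ 25
α₁/α₂ squares, and ρ^(-t) α₁/α₂ = δ^(-t) α₁ α₂^(t-1). -/
theorem coverNumber_image_le_of_coverNumber_le {C : Set Plane} {f : Plane ≃ᵃ[ℝ] Plane}
    {t δ : ℝ} (hδ : 0 < δ) (hC : Bornology.IsBounded C)
    (h : (coverNumber (δ / minorAxis f) C : ℝ) ≤ (δ / minorAxis f) ^ (-t)) :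
    (coverNumber δ (f '' C) : ℝ) ≤
      25 * δ ^ (-t) * (majorAxis f * minorAxis f ^ (t - 1)) := by
  have hm := minorAxis_pos f
  have hM := majorAxis_pos f
  have hmM := minorAxis_le_majorAxis f
  refine (coverNumber_image_le f hδ (div_pos hδ hm) hC).trans ?_
  have h1 : 2 * (majorAxis f * (2 * (δ / minorAxis f))) / δ + 1 ≤
      5 * (majorAxis f / minorAxis f) := by
    have : 1 ≤ majorAxis f / minorAxis f := (one_le_div hm).2 hmM
    have : 2 * (majorAxis f * (2 * (δ / minorAxis f))) / δ = 4 * (majorAxis f / minorAxis f) := by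
      field_simp
      ring
    linarith
  have h2 : 2 * (minorAxis f * (2 * (δ / minorAxis f))) / δ + 1 = 5 := by
    field_simp
    norm_num
  rw [h2]
  calc _ ≤ (δ / minorAxis f) ^ (-t) * (5 * (majorAxis f / minorAxis f) * 5) := by gcongr
    _ = _ := by
      rw [Real.div_rpow hδ.le hm.le, Real.rpow_neg hm.le, Real.rpow_sub_one hm.ne']
      field_simp
      norm_num

/-- Here n bounds the generations still needed before α₂ ≤ δ/d. Each visited word pays its own term,
and the bound sums over all words up to length n, visited or not. -/
theorem coverNumber_image_attractor_le (I : AffineIFS 2 N) {C F : Set Plane} {p : Plane}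
    {a c d r t δ : ℝ} (ht : 1 ≤ t) (ha : 0 < a) (hc0 : 0 < c) (hd : 0 < d) (hδ : 0 < δ)
    (hr : 0 ≤ r) (hF : F ⊆ Metric.closedBall p r) (hFC : F = (⋃ i, I.map i '' F) ∪ C)
    (hai : ∀ i, a ≤ minorAxis (I.map i)) (hci : ∀ i, majorAxis (I.map i) ≤ c)
    (hC : ∀ ρ, 0 < ρ → ρ < d → (coverNumber ρ C : ℝ) ≤ ρ ^ (-t)) (n : ℕ)
    (f : Plane ≃ᵃ[ℝ] Plane) (hl : a * (δ / d) ≤ minorAxis f)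
    (hu : majorAxis f * c ^ n ≤ δ / d) :
    (coverNumber δ (f '' F) : ℝ) ≤
      ((2 * r + d / a) * (2 * r / d + 1) * (d / a) ^ (t - 1) + 25) * δ ^ (-t) *
        ∑ j ∈ Finset.range (n + 1), wordSum j fun w =>
          majorAxis (f * I.comp w) * minorAxis (f * I.comp w) ^ (t - 1) := by
  have hA : 0 ≤ (2 * r + d / a) * (2 * r / d + 1) * (d / a) ^ (t - 1) := by positivity
  set A := (2 * r + d / a) * (2 * r / d + 1) * (d / a) ^ (t - 1)
  have hnn : ∀ f : Plane ≃ᵃ[ℝ] Plane, 0 ≤ majorAxis f * minorAxis f ^ (t - 1) := fun f =>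
    mul_nonneg (majorAxis_pos f).le (Real.rpow_nonneg (minorAxis_pos f).le _)
  have hleaf : ∀ n f, a * (δ / d) ≤ minorAxis f → minorAxis f ≤ δ / d →
      (coverNumber δ (f '' F) : ℝ) ≤ (A + 25) * δ ^ (-t) *
        ∑ j ∈ Finset.range (n + 1), wordSum j fun w =>
          majorAxis (f * I.comp w) * minorAxis (f * I.comp w) ^ (t - 1) := by
    intro n f h1 h2
    refine (coverNumber_image_le_of_minorAxis_le ht ha hd hδ hr hF h1 h2).trans ?_
    rw [Finset.sum_range_succ', wordSum_zero, AffineIFS.comp_nil, mul_one]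
    have : 0 ≤ ∑ j ∈ Finset.range n, wordSum (j + 1) fun w =>
        majorAxis (f * I.comp w) * minorAxis (f * I.comp w) ^ (t - 1) :=
      Finset.sum_nonneg fun j _ => wordSum_nonneg fun w => hnn _
    have := hnn f
    gcongr <;> linarith
  induction n generalizing f with
  | zero => exact hleaf 0 f hl ((minorAxis_le_majorAxis f).trans (by simpa using hu))
  | succ n ih =>
    rcases le_or_gt (minorAxis f) (δ / d) with hs | hs
    · exact hleaf _ f hl hs
    have hm := minorAxis_pos f
    have hCF : C ⊆ F := hFC ▸ subset_union_right
    have hbF : Bornology.IsBounded F := Metric.isBounded_closedBall.subset hF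
    have himg : ∀ g : Plane ≃ᵃ[ℝ] Plane, Bornology.IsBounded (g '' F) := fun g =>
      (lipschitzWith_majorAxis g).isBounded_image hbF
    have hsplit : f '' F ⊆ (⋃ i, (f * I.map i) '' F) ∪ f '' C := by
      conv_lhs => rw [hFC]
      rw [image_union, image_iUnion]
      refine union_subset_union_left _ (iUnion_mono fun i => ?_)
      rw [← image_comp]
      rfl
    have hbU : Bornology.IsBounded (⋃ i, (f * I.map i) '' F) :=
      Bornology.isBounded_iUnion.2 fun i => himg _
    have hbC : Bornology.IsBounded (f '' C) := (himg f).subset (image_mono hCF)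
    have h1 : (coverNumber δ (f '' F) : ℝ) ≤
        (∑ i, (coverNumber δ ((f * I.map i) '' F) : ℝ)) + coverNumber δ (f '' C) := by
      have := (coverNumber_mono hδ (hbU.union hbC) hsplit).trans
        ((coverNumber_union_le hδ hbU hbC).trans
          (Nat.add_le_add_right (coverNumber_le_sum hδ (fun i => himg _) subset_rfl) _))
      exact_mod_cast this
    -- As α₂ > δ/d, the scale δ/α₂ is below d, where the covering bound for C holds.
    have h2 := coverNumber_image_le_of_coverNumber_le (t := t) hδ (hbF.subset hCF)
      (hC (δ / minorAxis f) (div_pos hδ hm) (by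
        rw [div_lt_iff₀ hm, mul_comm]; exact (div_lt_iff₀ hd).1 hs))
    have h3 := fun i => ih (f * I.map i)
      ((show a * (δ / d) ≤ minorAxis f * minorAxis (I.map i) by
        rw [mul_comm]; exact mul_le_mul hs.le (hai i) ha.le hm.le).trans (minorAxis_mul_le _ _))
      (by
        refine le_trans ?_ hu
        rw [pow_succ', ← mul_assoc]
        have := (majorAxis_mul_le f (I.map i)).trans
          (mul_le_mul_of_nonneg_left (hci i) (majorAxis_pos f).le)
        gcongr)
    rw [Finset.sum_range_succ', wordSum_zero, AffineIFS.comp_nil, mul_one, mul_add]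
    refine h1.trans (add_le_add ?_ ?_)
    · refine (Finset.sum_le_sum fun i _ => h3 i).trans_eq ?_
      rw [← Finset.mul_sum, Finset.sum_comm]
      simp_rw [wordSum_succ, AffineIFS.comp_cons, ← mul_assoc]
    · refine h2.trans ?_
      have := hnn f
      gcongr
      linarith

theorem upperBoxDim_attractor_le [NeZero N] (I : AffineIFS 2 N) {C F : Set Plane}
    (hF : IsAttractor I C F) (hdet : levelSum I 1 2 < 1) {t : ℝ} (ht : 1 ≤ t)
    (hs : affinityDim I < t) (hC : upperBoxDim C < t) : upperBoxDim F ≤ t := by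
  obtain ⟨hne, hcpt, hFC⟩ := hF
  obtain ⟨c, hc0, hc1, hci⟩ := I.exists_majorAxis_le
  obtain ⟨a, ha, hai⟩ := I.exists_le_minorAxis
  obtain ⟨d, hd, hdC⟩ := mem_nhdsGT_iff_exists_Ioo_subset.1 (eventually_coverNumber_le_rpow hC)
  obtain ⟨r, hr⟩ := hcpt.isBounded.subset_closedBall (0 : Plane)
  have hr' : F ⊆ Metric.closedBall 0 (max r 0) :=
    hr.trans (Metric.closedBall_subset_closedBall (le_max_left _ _))
  -- For t > 2, φ^t is no longer α₁ α₂^(t-1); but α₂ ≤ 1, so that expression is dominated by φ at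
  -- `min t 2`, which still exceeds s.
  obtain ⟨B, hB⟩ := AffineIFS.exists_sum_levelSum_le hdet (t := min t 2)
    (le_min (by linarith) zero_le_two) (min_le_right _ _)
    (lt_min hs (AffineIFS.affinityDim_lt_two hdet))
  have hψ : ∀ w, majorAxis (I.comp w) * minorAxis (I.comp w) ^ (t - 1) ≤
      phi (min t 2) (I.comp w) := fun w => by
    rw [phi_of_one_le (le_min ht one_le_two) (min_le_right _ _)]
    refine mul_le_mul_of_nonneg_left ?_ (majorAxis_pos _).le
    exact Real.rpow_le_rpow_of_exponent_ge (minorAxis_pos _)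
      ((minorAxis_le_majorAxis _).trans (AffineIFS.majorAxis_comp_le_one w))
      (sub_le_sub_right (min_le_left _ _) _)
  have hB0 : 0 ≤ B := by simpa using hB 0
  have hd0 : (0 : ℝ) < d := hd
  set A := (2 * max r 0 + d / a) * (2 * max r 0 / d + 1) * (d / a) ^ (t - 1) + 25
  have hA : 0 < A := by positivity
  refine upperBoxDim_le_of_coverNumber_le (c := A * (B + 1)) hcpt.isBounded hne (by positivity) ?_
  filter_upwards [Ioo_mem_nhdsGT hd0] with δ ⟨h0, h1⟩
  obtain ⟨n, hn⟩ := exists_pow_lt_of_lt_one (div_pos h0 hd0) hc1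
  have ha1 : a ≤ 1 := ((hai 0).trans (minorAxis_le_majorAxis _)).trans ((hci 0).trans hc1.le)
  have key := coverNumber_image_attractor_le I ht ha hc0 hd0 h0 (le_max_right _ _) hr' hFC hai hci
    (fun ρ hρ hρd => hdC ⟨hρ, hρd⟩) n 1
    (by
      rw [minorAxis_one]
      exact mul_le_one₀ ha1 (by positivity) ((div_le_one hd0).2 h1.le))
    (by rw [majorAxis_one, one_mul]; exact hn.le)
  simp only [one_mul] at key
  rw [show ((1 : Plane ≃ᵃ[ℝ] Plane) : Plane → Plane) = id from rfl, image_id] at key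
  refine key.trans ?_
  rw [mul_right_comm]
  gcongr
  calc _ ≤ ∑ j ∈ Finset.range (n + 1), levelSum I j (min t 2) :=
        Finset.sum_le_sum fun j _ => (wordSum_le fun w _ => hψ w).trans_eq (I.levelSum_eq _ _).symm
    _ ≤ B + 1 := (hB _).trans (by linarith)

/-! ### Disjoint images under the condensation open set condition -/

theorem AffineIFS.comp_cons_image (I : AffineIFS 2 N) (i : Fin N) (w : List (Fin N))
    (s : Set Plane) : I.comp (i :: w) '' s = I.map i '' (I.comp w '' s) := by
  rw [comp_cons, ← image_comp]
  rfl

theorem AffineIFS.comp_image_subset {I : AffineIFS 2 N} {U : Set Plane}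
    (hU : ∀ i, I.map i '' U ⊆ U) (w : List (Fin N)) : I.comp w '' U ⊆ U := by
  induction w with
  | nil => exact (image_id U).subset
  | cons i w ih =>
    rw [comp_cons_image]
    exact (image_mono ih).trans (hU i)

/-- Cancel the common prefix. Either two different first letters remain, or one word is exhausted
and V is compared with a subset of some S_i(U). So one word may extend the other. -/
theorem AffineIFS.disjoint_comp_image {I : AffineIFS 2 N} {U V : Set Plane}
    (hU : ∀ i, I.map i '' U ⊆ U)
    (hdisj : ∀ i j, i ≠ j → (I.map i '' U) ∩ (I.map j '' U) = ∅) (hV : V ⊆ U)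
    (hVU : ∀ i, Disjoint V (I.map i '' U)) {u v : List (Fin N)} (huv : u ≠ v) :
    Disjoint (I.comp u '' V) (I.comp v '' V) := by
  have hsub : ∀ w, I.comp w '' V ⊆ U := fun w =>
    (image_mono hV).trans (AffineIFS.comp_image_subset hU w)
  have hnil : ∀ i w, Disjoint (I.comp [] '' V) (I.comp (i :: w) '' V) := fun i w => by
    rw [comp_cons_image, show I.comp [] '' V = V from image_id V]
    exact (hVU i).mono_right (image_mono (hsub w))
  induction u generalizing v with
  | nil =>
    cases v with
    | nil => exact absurd rfl huv
    | cons j v => exact hnil j v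
  | cons i u ih =>
    cases v with
    | nil => exact (hnil i u).symm
    | cons j v =>
      rw [comp_cons_image, comp_cons_image]
      rcases eq_or_ne i j with rfl | hij
      · rw [disjoint_image_iff (I.map i).injective]
        exact ih fun h => huv (by rw [h])
      · exact (disjoint_iff_inter_eq_empty.2 (hdisj i j hij)).mono (image_mono (hsub u))
          (image_mono (hsub v))

theorem ball_subset_image_ball (f : Plane ≃ᵃ[ℝ] Plane) (x : Plane) (r : ℝ) :
    Metric.ball (f x) (minorAxis f * r) ⊆ f '' Metric.ball x r := by
  intro y hy
  refine ⟨f.symm y, ?_, f.apply_symm_apply y⟩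
  have h := minorAxis_mul_dist_le f (f.symm y) x
  rw [f.apply_symm_apply] at h
  exact lt_of_mul_lt_mul_left (h.trans_lt hy) (minorAxis_pos f).le

open MeasureTheory in
theorem volume_image_affine (f : Plane ≃ᵃ[ℝ] Plane) (s : Set Plane) :
    volume (f '' s) = ENNReal.ofReal (majorAxis f * minorAxis f) * volume s := by
  have h : f '' s = (fun y => y + f 0) '' ((f.linear : Plane →ₗ[ℝ] Plane) '' s) := by
    rw [← image_comp]
    refine image_congr fun x _ => ?_
    simpa using congrFun (AffineMap.decomp f.toAffineMap) x
  rw [h, image_add_right, measure_preimage_add_right, Measure.addHaar_image_linearMap,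
    majorAxis_mul_minorAxis]

open MeasureTheory in
theorem card_mul_sq_le {ι : Type*} (s : Finset ι) (x : ι → Plane) (q : Plane) {ρ R : ℝ}
    (hρ : 0 ≤ ρ) (hR : 0 ≤ R)
    (hd : (s : Set ι).PairwiseDisjoint fun i => Metric.ball (x i) ρ)
    (hx : ∀ i ∈ s, dist (x i) q ≤ R) : s.card * ρ ^ 2 ≤ (R + ρ) ^ 2 := by
  have h1 : volume (⋃ i ∈ s, Metric.ball (x i) ρ) ≤ volume (Metric.ball q (R + ρ)) := by
    refine measure_mono (iUnion₂_subset fun i hi => ?_)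
    refine Metric.ball_subset_ball' ?_
    linarith [hx i hi]
  rw [measure_biUnion_finset hd fun i _ => measurableSet_ball] at h1
  simp_rw [Measure.addHaar_ball volume _ hρ] at h1
  rw [Measure.addHaar_ball volume _ (add_nonneg hR hρ), Finset.sum_const, nsmul_eq_mul,
    ← mul_assoc, ENNReal.mul_le_mul_iff_left (Metric.measure_ball_pos _ _ one_pos).ne'
      measure_ball_lt_top.ne, finrank_euclideanSpace_fin, ← nsmul_eq_mul,
    ← ENNReal.ofReal_nsmul, ENNReal.ofReal_le_ofReal_iff (by positivity), nsmul_eq_mul] at h1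
  exact h1

theorem AffineIFS.map_image_thickening_subset [NeZero N] (I : AffineIFS 2 N) {F : Set Plane}
    (hF : ∀ i, I.map i '' F ⊆ F) (r : ℝ) (i : Fin N) :
    I.map i '' Metric.thickening r F ⊆ Metric.thickening r F := by
  rintro _ ⟨y, hy, rfl⟩
  obtain ⟨z, hz, hyz⟩ := Metric.mem_thickening_iff.1 hy
  refine Metric.mem_thickening_iff.2 ⟨I.map i z, hF i (mem_image_of_mem _ hz), ?_⟩
  refine lt_of_le_of_lt ((dist_map_le _ _ _).trans ?_) hyz
  refine mul_le_of_le_one_left dist_nonneg ?_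
  rw [← I.comp_singleton]
  exact majorAxis_comp_le_one _

open MeasureTheory in
-- The union O of all S_w(V) contains V and the S_i(O) disjointly, so |V| + ∑ |det A_i| |O| ≤ |O|. U
-- itself may have infinite area; O lies in a neighbourhood of F that the maps preserve, so its area
-- is finite.
theorem levelSum_one_two_lt_one [NeZero N] (I : AffineIFS 2 N) {F U V : Set Plane}
    (hFb : Bornology.IsBounded F) (hF : ∀ i, I.map i '' F ⊆ F) (hU : ∀ i, I.map i '' U ⊆ U)
    (hdisj : ∀ i j, i ≠ j → (I.map i '' U) ∩ (I.map j '' U) = ∅) (hV : V ⊆ U) {r : ℝ}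
    (hVF : V ⊆ Metric.thickening r F) (hVo : IsOpen V) (hVne : V.Nonempty)
    (hVU : ∀ i, Disjoint V (I.map i '' U)) : levelSum I 1 2 < 1 := by
  set O : Set Plane := ⋃ w, I.comp w '' V
  have hOU : O ⊆ U :=
    iUnion_subset fun w => (image_mono hV).trans (AffineIFS.comp_image_subset hU w)
  have hOF : O ⊆ Metric.thickening r F := iUnion_subset fun w => (image_mono hVF).trans
    (AffineIFS.comp_image_subset (I.map_image_thickening_subset hF r) w)
  have hopen : ∀ (f : Plane ≃ᵃ[ℝ] Plane) {s : Set Plane}, IsOpen s → IsOpen (f '' s) :=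
    fun f s hs => (AffineEquiv.toContinuousAffineEquiv f).toHomeomorph.isOpenMap _ hs
  have hO : IsOpen O := isOpen_iUnion fun w => hopen _ hVo
  have hVO : V ⊆ O := (image_id V).symm.subset.trans (subset_iUnion (fun w => I.comp w '' V) [])
  have hiO : ∀ i, I.map i '' O ⊆ O := fun i => by
    rw [image_iUnion]
    refine iUnion_subset fun w => ?_
    rw [← I.comp_cons_image]
    exact subset_iUnion (fun w => I.comp w '' V) (i :: w)
  have hfin : volume O < ⊤ := (hFb.thickening.subset hOF).measure_lt_top
  have hpos : 0 < volume V := hVo.measure_pos _ hVne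
  have hne : volume O ≠ 0 := (hpos.trans_le (measure_mono hVO)).ne'
  have hsum : volume V + ∑ i, volume (I.map i '' O) ≤ volume O := by
    rw [← measure_biUnion_finset (fun i _ j _ hij => ?_) fun i _ => (hopen _ hO).measurableSet,
      ← measure_union ?_ ?_]
    · exact measure_mono (union_subset hVO (iUnion₂_subset fun i _ => hiO i))
    · refine disjoint_iUnion₂_right.2 fun i _ => (hVU i).mono_right (image_mono hOU)
    · exact Finset.measurableSet_biUnion _ fun i _ => (hopen _ hO).measurableSet
    · exact (disjoint_iff_inter_eq_empty.2 (hdisj i j hij)).mono (image_mono hOU) (image_mono hOU)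
  have hl : levelSum I 1 2 = ∑ i, majorAxis (I.map i) * minorAxis (I.map i) := by
    rw [I.levelSum_eq, wordSum_one]
    refine Finset.sum_congr rfl fun i _ => ?_
    rw [I.comp_singleton, phi_of_one_le one_le_two le_rfl]
    norm_num
  simp_rw [volume_image_affine] at hsum
  rw [← Finset.sum_mul, ← ENNReal.ofReal_sum_of_nonneg fun i _ =>
    (mul_pos (majorAxis_pos _) (minorAxis_pos _)).le, ← hl] at hsum
  by_contra! h
  have h1 : volume O ≤ ENNReal.ofReal (levelSum I 1 2) * volume O :=
    le_mul_of_one_le_left zero_le (by simpa using h)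
  have h2 : volume V + volume O ≤ 0 + volume O := by
    rw [zero_add]
    exact (add_le_add_right h1 _).trans hsum
  exact hpos.not_ge ((ENNReal.add_le_add_iff_right hfin.ne).1 h2)

/-! ### Words with prescribed smaller singular value -/

/-- Take the first prefix with α₂ ≤ δ. It is not empty because δ < 1, and its last letter shrinks α₂
at most by the factor a. -/
theorem exists_take_minorAxis_mem [NeZero N] (I : AffineIFS 2 N) {a c δ : ℝ}
    (hδ : δ < 1) (hai : ∀ i, a ≤ minorAxis (I.map i)) (ha : 0 < a)
    (hci : ∀ i, majorAxis (I.map i) ≤ c) {L : ℕ} (hL : c ^ L ≤ δ) {w : List (Fin N)}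
    (hw : L ≤ w.length) :
    ∃ k ≤ L, minorAxis (I.comp (w.take k)) ∈ Icc (a * δ) δ := by
  classical
  have hex : ∃ k, minorAxis (I.comp (w.take k)) ≤ δ := by
    refine ⟨L, (minorAxis_le_majorAxis _).trans
      ((AffineIFS.majorAxis_comp_le hci _).trans ?_)⟩
    rwa [List.length_take_of_le hw]
  have hle : Nat.find hex ≤ L := by
    refine Nat.find_min' hex ((minorAxis_le_majorAxis _).trans
      ((AffineIFS.majorAxis_comp_le hci _).trans ?_))
    rwa [List.length_take_of_le hw]
  refine ⟨Nat.find hex, hle, ?_, Nat.find_spec hex⟩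
  rcases hk : Nat.find hex with _ | k
  · have := Nat.find_spec hex
    rw [hk, List.take_zero, AffineIFS.comp_nil, minorAxis_one] at this
    linarith
  · have h1 := Nat.find_min hex (m := k) (by omega)
    have hkw : k < w.length := by omega
    rw [List.take_succ_eq_append_getElem hkw, AffineIFS.comp_append, AffineIFS.comp_singleton,
      mul_comm]
    exact (mul_le_mul (not_le.1 h1).le (hai _) ha.le (minorAxis_pos _).le).trans
      (minorAxis_mul_le _ _)

theorem wordSum_take_mul_drop {k n : ℕ} (hk : k ≤ n) (g h : List (Fin N) → ℝ) :
    wordSum n (fun w => g (w.take k) * h (w.drop k)) = wordSum k g * wordSum (n - k) h := by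
  obtain ⟨m, rfl⟩ := Nat.exists_eq_add_of_le hk
  rw [wordSum_add, Nat.add_sub_cancel_left, ← wordSum_mul_right]
  refine wordSum_congr fun u hu => ?_
  rw [← wordSum_mul_left]
  refine wordSum_congr fun v _ => ?_
  rw [List.take_left' hu, List.drop_left' hu]

/-- Let q be the sum of the a_k and suppose q < 1. Summing the inequality over L ≤ n < L + R gives X
≤ q (B + X) for X = ∑ M n, so X is bounded independently of R, although X ≥ R. -/
theorem one_le_of_renewal {M a : ℕ → ℝ} {L : ℕ} (hM : ∀ n, 1 ≤ M n) (ha : ∀ k, 0 ≤ a k)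
    (h : ∀ n, L ≤ n → M n ≤ ∑ k ∈ Finset.range (L + 1), a k * M (n - k)) :
    1 ≤ ∑ k ∈ Finset.range (L + 1), a k := by
  set q := ∑ k ∈ Finset.range (L + 1), a k
  have hM0 : ∀ n, 0 ≤ M n := fun n => zero_le_one.trans (hM n)
  by_contra! hq
  have hq0 : 0 ≤ q := Finset.sum_nonneg fun k _ => ha k
  set B := ∑ j ∈ Finset.range L, M j
  obtain ⟨R, hR⟩ := exists_nat_gt (q * B / (1 - q))
  have h1 : ∑ m ∈ Finset.range R, M (L + m) ≤
      ∑ k ∈ Finset.range (L + 1), a k * ∑ j ∈ Finset.range (L + R), M j := by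
    refine (Finset.sum_le_sum fun m _ => h (L + m) (Nat.le_add_right _ _)).trans ?_
    rw [Finset.sum_comm]
    refine Finset.sum_le_sum fun k hk => ?_
    rw [← Finset.mul_sum]
    refine mul_le_mul_of_nonneg_left ?_ (ha k)
    have hk' : k ≤ L := Nat.lt_succ_iff.1 (Finset.mem_range.1 hk)
    calc ∑ m ∈ Finset.range R, M (L + m - k)
        = ∑ m ∈ Finset.range R, M (L - k + m) :=
          Finset.sum_congr rfl fun m _ => by congr 1; omega
      _ ≤ ∑ j ∈ Finset.range (L - k + R), M j := by
          rw [Finset.sum_range_add]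
          exact le_add_of_nonneg_left (Finset.sum_nonneg fun j _ => hM0 j)
      _ ≤ _ := Finset.sum_le_sum_of_subset_of_nonneg
          (Finset.range_mono (by omega)) fun j _ _ => hM0 j
  rw [← Finset.sum_mul, Finset.sum_range_add M] at h1
  have h2 : (R : ℝ) ≤ ∑ m ∈ Finset.range R, M (L + m) := by
    simpa using Finset.card_nsmul_le_sum (Finset.range R) (fun m => M (L + m)) 1 fun m _ => hM _
  rw [div_lt_iff₀ (by linarith)] at hR
  change _ ≤ q * (B + _) at h1
  nlinarith

/-- Every long word has a prefix in W, so splitting there bounds level sums by a renewal inequality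
whose coefficients are the φ^t-sums over W by length. W need not be prefix-free, since disjointness
is available for all pairs of words. -/
theorem exists_finset_words [NeZero N] (I : AffineIFS 2 N) {a δ t : ℝ}
    (hδ0 : 0 < δ) (hδ : δ < 1) (hai : ∀ i, a ≤ minorAxis (I.map i)) (ha : 0 < a)
    (h0 : 0 ≤ t) (h2 : t ≤ 2) (hM : ∀ k, 1 ≤ levelSum I k t) :
    ∃ W : Finset (List (Fin N)), (∀ w ∈ W, minorAxis (I.comp w) ∈ Icc (a * δ) δ) ∧
      1 ≤ ∑ w ∈ W, phi t (I.comp w) := by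
  classical
  obtain ⟨c, hc0, hc1, hci⟩ := I.exists_majorAxis_le
  obtain ⟨L, hL⟩ := exists_pow_lt_of_lt_one hδ0 hc1
  have hpos := fun f => (phi_pos h0 h2 f).le
  let P : List (Fin N) → Prop := fun w => minorAxis (I.comp w) ∈ Icc (a * δ) δ
  let g : List (Fin N) → ℝ := fun w => if P w then phi t (I.comp w) else 0
  have hg : ∀ w, 0 ≤ g w := fun w => by
    simp only [g]
    split_ifs
    exacts [hpos _, le_rfl]
  let W : Finset (List (Fin N)) := ((Finset.range (L + 1)).sigma fun k =>
    (Finset.univ : Finset (Fin k → Fin N)).filter fun w => P (List.ofFn w)).map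
      List.equivSigmaTuple.symm.toEmbedding
  refine ⟨W, fun w hw => ?_, ?_⟩
  · obtain ⟨u, hu, rfl⟩ := Finset.mem_map.1 hw
    exact (Finset.mem_filter.1 (Finset.mem_sigma.1 hu).2).2
  have hW : ∑ w ∈ W, phi t (I.comp w) = ∑ k ∈ Finset.range (L + 1), wordSum k g := by
    rw [Finset.sum_map, Finset.sum_sigma]
    refine Finset.sum_congr rfl fun k _ => ?_
    rw [Finset.sum_filter]
    rfl
  rw [hW]
  refine one_le_of_renewal hM (fun k => wordSum_nonneg hg) fun n hn => ?_
  rw [Finset.sum_congr rfl fun k hk => by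
    rw [I.levelSum_eq, ← wordSum_take_mul_drop
      ((Nat.lt_succ_iff.1 (Finset.mem_range.1 hk)).trans hn)], ← wordSum_sum, I.levelSum_eq]
  refine wordSum_le fun w hw => ?_
  obtain ⟨k, hk, hkw⟩ := exists_take_minorAxis_mem I hδ hai ha hci hL.le (hn.trans_eq hw.symm)
  refine le_trans ?_ (Finset.single_le_sum (f := fun k => g (w.take k) * phi t (I.comp (w.drop k)))
    (fun j _ => mul_nonneg (hg _) (hpos _)) (Finset.mem_range.2 (Nat.lt_succ_of_le hk)))
  simp only [g, P, if_pos hkw]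
  conv_lhs => rw [← List.take_append_drop k w, I.comp_append]
  exact phi_mul_le h0 h2 _ _

/-! ### The lower bound -/

/-- Non-collinearity yields p, q in K with p - x, q - x a basis, and the norm of a linear map is
controlled by its values on a basis. The constant does not depend on f, whatever its contracting
direction. -/
theorem exists_majorAxis_mul_le_dist {K : Set Plane} (hK : ¬ Collinear ℝ K) {x : Plane}
    (hx : x ∈ K) : ∃ D, 0 < D ∧ ∀ f : Plane ≃ᵃ[ℝ] Plane,
      ∃ y ∈ K, D * majorAxis f ≤ dist (f y) (f x) := by
  rw [collinear_iff_of_mem hx] at hK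
  push Not at hK
  obtain ⟨p, hp, hp'⟩ := hK 0
  obtain ⟨q, hq, hq'⟩ := hK (p - x)
  have hpx : p - x ≠ 0 := fun h => hp' 0 (by simpa [sub_eq_zero] using h)
  have hli : LinearIndependent ℝ ![p - x, q - x] :=
    (LinearIndependent.pair_iff' hpx).2 fun r hr => hq' r (by simp [hr])
  let b := basisOfLinearIndependentOfCardEqFinrank hli (by simp)
  obtain ⟨C, hC, h⟩ := b.exists_opNorm_le (F := Plane)
  refine ⟨C⁻¹, inv_pos.2 hC, fun f => ?_⟩
  have hb : ∀ i, b i = ![p - x, q - x] i := fun i => by simp [b]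
  have key : majorAxis f ≤ C * max (dist (f p) (f x)) (dist (f q) (f x)) := by
    have hle := h (u := LinearMap.toContinuousLinearMap (f.linear : Plane →ₗ[ℝ] Plane))
      (M := max (dist (f p) (f x)) (dist (f q) (f x))) (le_max_of_le_left dist_nonneg)
      (Fin.forall_fin_two.2 ⟨?_, ?_⟩)
    · exact (singularValues_zero_le fun y => ContinuousLinearMap.le_opNorm
        (LinearMap.toContinuousLinearMap (f.linear : Plane →ₗ[ℝ] Plane)) y).trans hle
    · rw [hb, dist_map_eq_norm]
      exact le_max_left _ _
    · rw [hb, dist_map_eq_norm f q]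
      exact le_max_right _ _
  rw [← inv_mul_le_iff₀ hC] at key
  rcases le_max_iff.1 key with h' | h'
  exacts [⟨p, hp, h'⟩, ⟨q, hq, h'⟩]

/-- Double counting of pairs (word, square meeting S_w(K)): connectedness bounds below the squares
per word, and disjointness bounds above the words per square. -/
theorem sum_majorAxis_le_coverNumber (I : AffineIFS 2 N) {F K V : Set Plane}
    {a r δ D : ℝ} (hδ : 0 < δ) (ha : 0 < a) (hr : 0 < r) (hFb : Bornology.IsBounded F)
    (hKF : ∀ w, I.comp w '' K ⊆ F) (hK : IsPreconnected K)
    (hD : ∀ f : Plane ≃ᵃ[ℝ] Plane, ∃ y ∈ K, ∃ z ∈ K, D * majorAxis f ≤ dist (f y) (f z))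
    (hKV : ∀ x ∈ K, Metric.ball x r ⊆ V)
    (hV : ∀ u v, u ≠ v → Disjoint (I.comp u '' V) (I.comp v '' V))
    (W : Finset (List (Fin N))) (hW : ∀ w ∈ W, a * δ ≤ minorAxis (I.comp w)) :
    ∑ w ∈ W, D * majorAxis (I.comp w) ≤
      ((2 + a * r) / (a * r)) ^ 2 * (2 * δ) * coverNumber δ F := by
  classical
  obtain ⟨Q, hQ, hFQ⟩ := exists_cover hδ hFb
  let R : List (Fin N) → Fin (coverNumber δ F) → Prop := fun w j => (Q j ∩ I.comp w '' K).Nonempty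
  have h1 : ∀ w, D * majorAxis (I.comp w) ≤
      (Finset.univ.bipartiteAbove R w).card * (2 * δ) := by
    intro w
    obtain ⟨y, hy, z, hz, hyz⟩ := hD (I.comp w)
    refine hyz.trans (dist_le_card_mul (hK.image _ (AffineEquiv.continuous_of_finiteDimensional
      _).continuousOn) _ hQ ?_ hδ (mem_image_of_mem _ hy) (mem_image_of_mem _ hz))
    intro v hv
    obtain ⟨j, hj⟩ := mem_iUnion.1 (hFQ (hKF w hv))
    exact mem_iUnion₂.2 ⟨j, Finset.mem_filter.2 ⟨Finset.mem_univ _, v, hj, hv⟩, hj⟩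
  have h2 : ∀ j, ((W.bipartiteBelow R j).card : ℝ) ≤ ((2 + a * r) / (a * r)) ^ 2 := by
    intro j
    rcases (W.bipartiteBelow R j).eq_empty_or_nonempty with he | ⟨w₀, hw₀⟩
    · rw [he]
      simpa using sq_nonneg _
    have hex : ∀ w, ∃ x, w ∈ W.bipartiteBelow R j → x ∈ K ∧ I.comp w x ∈ Q j := by
      intro w
      by_cases hw : w ∈ W.bipartiteBelow R j
      · obtain ⟨_, hy, x, hx, rfl⟩ := (Finset.mem_filter.1 hw).2
        exact ⟨x, fun _ => ⟨hx, hy⟩⟩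
      · exact ⟨0, fun h => absurd h hw⟩
    choose x hx using hex
    have hball : ∀ w ∈ W.bipartiteBelow R j,
        Metric.ball (I.comp w (x w)) (a * δ * r) ⊆ I.comp w '' V := fun w hw =>
      (Metric.ball_subset_ball (mul_le_mul_of_nonneg_right (hW w (Finset.mem_filter.1 hw).1)
        hr.le)).trans ((ball_subset_image_ball _ _ _).trans (image_mono (hKV _ (hx w hw).1)))
    -- Disjoint balls of radius aδr have centres in one square of diameter at most 2δ; comparing
    -- areas bounds their number.
    have hc := card_mul_sq_le (W.bipartiteBelow R j) (fun w => I.comp w (x w))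
      (I.comp w₀ (x w₀)) (ρ := a * δ * r) (R := 2 * δ) (by positivity) (by positivity)
      (fun u hu v hv huv => (hV u v huv).mono (hball u hu) (hball v hv))
      (fun w hw => (hQ j).dist_le (hx w hw).2 (hx w₀ hw₀).2)
    rw [div_pow, le_div_iff₀ (by positivity)]
    refine le_of_mul_le_mul_right ?_ (pow_pos hδ 2)
    calc _ = ((W.bipartiteBelow R j).card : ℝ) * (a * δ * r) ^ 2 := by ring
      _ ≤ _ := hc
      _ = _ := by ring
  have h3 : ∑ w ∈ W, ((Finset.univ.bipartiteAbove R w).card : ℝ) =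
      ∑ j, ((W.bipartiteBelow R j).card : ℝ) := by
    exact_mod_cast Finset.sum_card_bipartiteAbove_eq_sum_card_bipartiteBelow R
  calc _ ≤ ∑ w ∈ W, ((Finset.univ.bipartiteAbove R w).card : ℝ) * (2 * δ) :=
        Finset.sum_le_sum fun w _ => h1 w
    _ = (∑ j, ((W.bipartiteBelow R j).card : ℝ)) * (2 * δ) := by rw [← Finset.sum_mul, h3]
    _ ≤ (∑ j : Fin (coverNumber δ F), ((2 + a * r) / (a * r)) ^ 2) * (2 * δ) := by
        gcongr with j
        exact h2 j
    _ = _ := by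
        simp only [Finset.sum_const, Finset.card_univ, Fintype.card_fin, nsmul_eq_mul]
        ring

theorem le_lowerBoxDim_of_levelSum [NeZero N] (I : AffineIFS 2 N) {F K V : Set Plane}
    {r D t : ℝ} (hr : 0 < r) (hD0 : 0 < D) (h1 : 1 ≤ t) (h2 : t ≤ 2)
    (hM : ∀ k, 1 ≤ levelSum I k t) (hFb : Bornology.IsBounded F)
    (hKF : ∀ w, I.comp w '' K ⊆ F) (hK : IsPreconnected K)
    (hD : ∀ f : Plane ≃ᵃ[ℝ] Plane, ∃ y ∈ K, ∃ z ∈ K, D * majorAxis f ≤ dist (f y) (f z))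
    (hKV : ∀ x ∈ K, Metric.ball x r ⊆ V)
    (hV : ∀ u v, u ≠ v → Disjoint (I.comp u '' V) (I.comp v '' V)) :
    t ≤ lowerBoxDim F := by
  obtain ⟨a, ha, hai⟩ := I.exists_le_minorAxis
  set M := ((2 + a * r) / (a * r)) ^ 2 * 2
  have hM0 : 0 < M := by positivity
  refine le_lowerBoxDim_of_le_coverNumber (c := D / M) (by positivity) ?_
  filter_upwards [eventually_lt_one] with δ ⟨hδ0, hδ1⟩
  obtain ⟨W, hW, hsum⟩ := exists_finset_words I hδ0 hδ1 hai ha (zero_le_one.trans h1) h2 hM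
  have key := sum_majorAxis_le_coverNumber I hδ0 ha hr hFb hKF hK hD hKV hV W
    fun w hw => (hW w hw).1
  -- Since α₂ ≤ δ and t ≥ 1, φ^t ≤ α₁ δ^(t-1).
  have hphi : ∀ w ∈ W, δ * δ ^ (-t) * phi t (I.comp w) ≤ majorAxis (I.comp w) := by
    intro w hw
    rw [phi_of_one_le h1 h2]
    have hle : minorAxis (I.comp w) ^ (t - 1) ≤ δ ^ (t - 1) :=
      Real.rpow_le_rpow (minorAxis_pos _).le (hW w hw).2 (by linarith)
    have hM := (majorAxis_pos (I.comp w)).le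
    calc _ ≤ δ * δ ^ (-t) * (majorAxis (I.comp w) * δ ^ (t - 1)) := by gcongr
      _ = majorAxis (I.comp w) * (δ * (δ ^ (-t) * δ ^ (t - 1))) := by ring
      _ = majorAxis (I.comp w) := by
        rw [← Real.rpow_add hδ0, show -t + (t - 1) = -1 by ring, Real.rpow_neg_one,
          mul_inv_cancel₀ hδ0.ne', mul_one]
  rw [div_mul_eq_mul_div, div_le_iff₀ hM0]
  refine le_of_mul_le_mul_right ?_ hδ0
  calc D * δ ^ (-t) * δ = D * (δ * δ ^ (-t)) * 1 := by ring
    _ ≤ D * (δ * δ ^ (-t)) * ∑ w ∈ W, phi t (I.comp w) := by gcongr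
    _ = ∑ w ∈ W, D * (δ * δ ^ (-t) * phi t (I.comp w)) := by
        rw [Finset.mul_sum]
        exact Finset.sum_congr rfl fun w _ => by ring
    _ ≤ ∑ w ∈ W, D * majorAxis (I.comp w) :=
        Finset.sum_le_sum fun w hw => mul_le_mul_of_nonneg_left (hphi w hw) hD0.le
    _ ≤ _ := key
    _ = _ := by ring

theorem one_le_lowerBoxDim {C K : Set Plane} (hC : Bornology.IsBounded C) (hKC : K ⊆ C)
    (hK : IsPreconnected K) {x y : Plane} (hx : x ∈ K) (hy : y ∈ K) (hxy : x ≠ y) :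
    1 ≤ lowerBoxDim C := by
  have hd := dist_pos.2 hxy
  refine le_lowerBoxDim_of_le_coverNumber (t := 1) (c := dist x y / 2) (by positivity) ?_
  filter_upwards [eventually_lt_one] with δ ⟨h0, h1⟩
  obtain ⟨Q, hQ, hCQ⟩ := exists_cover h0 hC
  have h := dist_le_card_mul hK Finset.univ hQ (by simpa using hKC.trans hCQ) h0 hx hy
  rw [Finset.card_univ, Fintype.card_fin] at h
  rw [Real.rpow_neg_one, ← div_eq_mul_inv, div_le_iff₀ h0]
  linarith

end SelfAffine

/-! ### The main theorem -/

theorem corollary2p5 {N : ℕ} [NeZero N] (I : SelfAffine.AffineIFS 2 N)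
    (C : Set (EuclideanSpace ℝ (Fin 2))) (hC : IsCompact C)
    (hCOSC : SelfAffine.COSC I C)
    (hcomp : ∃ x ∈ C, ¬ Collinear ℝ (connectedComponentIn C x)) :
    SelfAffine.upperBoxDim (SelfAffine.attractor I C hC) =
        max (SelfAffine.affinityDim I : EReal) (SelfAffine.upperBoxDim C) ∧
      max (SelfAffine.affinityDim I : EReal) (SelfAffine.lowerBoxDim C) ≤
        SelfAffine.lowerBoxDim (SelfAffine.attractor I C hC) ∧
      SelfAffine.lowerBoxDim (SelfAffine.attractor I C hC) ≤
        max (SelfAffine.affinityDim I : EReal) (SelfAffine.upperBoxDim C) := by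
  have hF := SelfAffine.attractor_isAttractor I C hC
  set F := SelfAffine.attractor I C hC
  obtain ⟨U, hUo, hCU, hU, hdisj⟩ := hCOSC
  obtain ⟨x, hx, hncol⟩ := hcomp
  have hFb : Bornology.IsBounded F := hF.2.1.isBounded
  have hCne : C.Nonempty := ⟨x, hx⟩
  have hCF : C ⊆ F := by
    rw [hF.2.2]
    exact subset_union_right
  have hSF : ∀ i, I.map i '' F ⊆ F := fun i => by
    conv_rhs => rw [hF.2.2]
    exact subset_union_of_subset_left (subset_iUnion (fun i => I.map i '' F) i) _
  -- By compactness, a uniform neighbourhood of C stays in U and off the closures of all S_i(U).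
  obtain ⟨r, hr, hrU⟩ := hC.exists_thickening_subset_open
    (hUo.sdiff (isClosed_iUnion_of_finite fun i => isClosed_closure)) hCU
  set V := Metric.thickening r C
  have hVU : V ⊆ U := hrU.trans sdiff_subset
  have hVi : ∀ i, Disjoint V (I.map i '' U) := fun i =>
    disjoint_left.2 fun y hy hyi => (hrU hy).2 (mem_iUnion.2 ⟨i, subset_closure hyi⟩)
  have hdet : SelfAffine.levelSum I 1 2 < 1 :=
    SelfAffine.levelSum_one_two_lt_one I hFb hSF hU hdisj hVU
      (Metric.thickening_subset_of_subset r hCF) Metric.isOpen_thickening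
      (hCne.mono (Metric.self_subset_thickening hr C)) hVi
  set K := connectedComponentIn C x
  have hxK : x ∈ K := mem_connectedComponentIn hx
  have hKC : K ⊆ C := connectedComponentIn_subset C x
  have hK : IsPreconnected K := isPreconnected_connectedComponentIn
  obtain ⟨D, hD0, hD⟩ := SelfAffine.exists_majorAxis_mul_le_dist hncol hxK
  have hone : 1 ≤ SelfAffine.lowerBoxDim C := by
    obtain ⟨y, hy, hyx⟩ := hD 1
    rw [SelfAffine.majorAxis_one, mul_one] at hyx
    exact SelfAffine.one_le_lowerBoxDim hC.isBounded hKC hK hy hxK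
      (dist_pos.1 (hD0.trans_le hyx))
  have hlow : SelfAffine.lowerBoxDim C ≤ SelfAffine.lowerBoxDim F :=
    SelfAffine.lowerBoxDim_mono hFb hCne hCF
  have hs : (SelfAffine.affinityDim I : EReal) ≤ SelfAffine.lowerBoxDim F := by
    refine EReal.ge_of_forall_gt_iff_ge.1 fun t ht => ?_
    rw [EReal.coe_lt_coe_iff] at ht
    -- For t ≤ 1 the connected set inside C suffices; the counting argument needs t ≥ 1.
    rcases le_or_gt t 1 with h1 | h1
    · exact (EReal.coe_le_coe_iff.2 h1).trans (hone.trans hlow)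
    · refine SelfAffine.le_lowerBoxDim_of_levelSum I hr hD0 h1.le
        (ht.trans (SelfAffine.AffineIFS.affinityDim_lt_two hdet)).le
        (SelfAffine.AffineIFS.one_le_levelSum hdet (by linarith) ht) hFb
        (fun w => (image_mono (hKC.trans hCF)).trans
          (SelfAffine.AffineIFS.comp_image_subset hSF w)) hK
        (fun f => ?_) (fun y hy => Metric.ball_subset_thickening (hKC hy) r)
        (fun u v => SelfAffine.AffineIFS.disjoint_comp_image hU hdisj hVU hVi)
      obtain ⟨y, hy, hyx⟩ := hD f
      exact ⟨y, hy, x, hxK, hyx⟩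
  have hup : SelfAffine.upperBoxDim F ≤
      max (SelfAffine.affinityDim I : EReal) (SelfAffine.upperBoxDim C) := by
    refine EReal.le_of_forall_lt_iff_le.1 fun t ht => ?_
    obtain ⟨hst, hCt⟩ := max_lt_iff.1 ht
    have h1 : (1 : EReal) ≤ t :=
      hone.trans (SelfAffine.lowerBoxDim_le_upperBoxDim.trans hCt.le)
    exact SelfAffine.upperBoxDim_attractor_le I hF hdet (EReal.coe_le_coe_iff.1 h1)
      (EReal.coe_lt_coe_iff.1 hst) hCt
  refine ⟨le_antisymm hup (max_le (hs.trans SelfAffine.lowerBoxDim_le_upperBoxDim)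
    (SelfAffine.upperBoxDim_mono hFb hCne hCF)), max_le hs hlow,
    SelfAffine.lowerBoxDim_le_upperBoxDim.trans hup⟩
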